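/- Conventions. For a $C^*$-algebra $A$, $M(A)$ is its multiplier algebra. An endomorphism $\alpha$ of $A$ is \emph{extendible} if it extends to a strictly continuous endomorphism $\overline\alpha$ of $M(A)$ (not necessarily unital). An \emph{Exel system} $(A,\alpha,L)$ consists of a (possibly non-unital) $C^*$-algebra $A$, an extendible endomorphism $\alpha$ of $A$, and a positive linear map $L:A\to A$ that extends to a positive linear map $\overline L:M(A)\to M(A)$ with $L(\alpha(a)m)=a\overline L(m)$ for $a\in A$, $m\in M(A)$, and $\overline L(1)=1$. Let $M_L$ be the right-Hilbert $A$-bimodule obtained from $A$, with $a\cdot m=am$, $m\cdot b=m\alpha(b)$ and $\langle m,n\rangle=L(m^*n)$, by dividing out the vectors of length zero and completing; let $q:A\to M_L$ be the canonical map, $\phi(a)$ the operator of left multiplication by $a$ on $M_L$, and $\mathcal K(M_L)$ the closed span of the operators $\Theta_{m,n}:p\mapsto m\cdot\langle n,p\rangle$. A \emph{Toeplitz-covariant representation} of $(A,\alpha,L)$ in a $C^*$-algebra $B$ is a pair $(\pi,S)$ of a nondegenerate homomorphism $\pi:A\to B$ and an element $S\in M(B)$ with $S\pi(a)=\pi(\alpha(a))S$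 and $S^*\pi(a)S=\pi(L(a))$ for all $a\in A$. Let $\mathcal T(A,\alpha,L)$ be the $C^*$-algebra generated by $i(A)\cup i(A)s$ for a universal Toeplitz-covariant representation $(i,s)$, let $\psi_s:M_L\to\mathcal T(A,\alpha,L)$ be the bounded linear map with $\psi_s(q(a))=i(a)s$, let $(\psi_s,i)^{(1)}:\mathcal K(M_L)\to\mathcal T(A,\alpha,L)$ be the homomorphism with $\Theta_{m,n}\mapsto\psi_s(m)\psi_s(n)^*$, and let $K_\alpha:=\overline{A\alpha(A)A}\cap\phi^{-1}(\mathcal K(M_L))$, where $\overline{A\alpha(A)A}$ is the closed span of the products. The \emph{Exel crossed product} $A\rtimes_{\alpha,L}\mathbb N$ is the quotient of $\mathcal T(A,\alpha,L)$ by the closed ideal generated by $\{i(a)-(\psi_s,i)^{(1)}(\phi(a)):a\in K_\alpha\}$. Let $j:A\to A\rtimes_{\alpha,L}\mathbb N$ and $t\in M(A\rtimes_{\alpha,L}\mathbb N)$ be the images of $i$ and $s$, and let $\hat\alpha$ be the dual action of $\mathbb T$ on $A\rtimes_{\alpha,L}\mathbb N$, given by $\hat\alpha_z(j(a))=j(a)$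 and $\hat\alpha_z(j(a)t)=z\,j(a)t$, with fixed-point algebra $(A\rtimes_{\alpha,L}\mathbb N)^{\hat\alpha}$. For an endomorphism $\beta$ of a $C^*$-algebra $B$, a \emph{Stacey-covariant representation} of $(B,\beta)$ in a $C^*$-algebra $D$ is a pair $(\pi,V)$ of a nondegenerate homomorphism $\pi:B\to D$ and an isometry $V\in M(D)$ with $\pi(\beta(b))=V\pi(b)V^*$ for all $b\in B$. The \emph{Stacey crossed product} $B\times_\beta\mathbb N$ is the $C^*$-algebra generated by $i_B(B)\cup i_B(B)v$ for a universal Stacey-covariant representation $(i_B,v)$; for a Stacey-covariant representation $(\pi,V)$ in $D$, $\pi\times V:B\times_\beta\mathbb N\to D$ is the nondegenerate homomorphism with $(\pi\times V)\circ i_B=\pi$ and $\overline{\pi\times V}(v)=V$. Corollary. Suppose that $(A,\alpha,L)$ is an Exel system. Then there is an injective endomorphism $\beta$ of $(A\rtimes_{\alpha,L}\mathbb N)^{\hat\alpha}$ such that, for all $a,b\in A$ and $i\in\mathbb N=\{0,1,2,\dots\}$, $j(a)t^it^{*i}j(b)\in(A\rtimes_{\alpha,L}\mathbb N)^{\hat\alpha}$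 and $$\beta\big(j(a)t^it^{*i}j(b)\big)=j(\alpha(a))\,t^{i+1}t^{*(i+1)}\,j(\alpha(b)).$$ The endomorphism $\beta$ is extendible with $\overline\beta(1)=tt^*$ and has range $tt^*(A\rtimes_{\alpha,L}\mathbb N)^{\hat\alpha}tt^*$. The pair $(\operatorname{id},t)$, where $\operatorname{id}$ is the inclusion of $(A\rtimes_{\alpha,L}\mathbb N)^{\hat\alpha}$ in $A\rtimes_{\alpha,L}\mathbb N$, is a Stacey-covariant representation of $\big((A\rtimes_{\alpha,L}\mathbb N)^{\hat\alpha},\beta\big)$, and $\operatorname{id}\times t$ is an isomorphism of the Stacey crossed product $(A\rtimes_{\alpha,L}\mathbb N)^{\hat\alpha}\times_\beta\mathbb N$ onto the Exel crossed product $A\rtimes_{\alpha,L}\mathbb N$. -/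

import Mathlib

open scoped MultiplierAlgebra Topology
open Filter

universe u

noncomputable section

namespace CrossedProduct

section Multipliers

variable {A B : Type*} [NonUnitalCStarAlgebra A] [NonUnitalCStarAlgebra B]

/-- The strict topology on the multiplier algebra: `mᵢ → m` strictly if and only if
`mᵢ a → m a` and `a mᵢ → a m` in norm for every `a : A`. (For a double centralizer `m`,
`m.fst a` is `m a` and `m.snd a` is `a m`.) -/
abbrev strictTopology (A : Type*) [NonUnitalCStarAlgebra A] : TopologicalSpace 𝓜(ℂ, A) :=
  TopologicalSpace.induced (fun m (a : A) => (m.fst a, m.snd a)) inferInstance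

/-- `αbar` is a strictly continuous endomorphism of `M(A)` that extends `α`. -/
def IsStrictExtension (α : A →⋆ₙₐ[ℂ] A) (αbar : 𝓜(ℂ, A) →⋆ₙₐ[ℂ] 𝓜(ℂ, A)) : Prop :=
  @Continuous _ _ (strictTopology A) (strictTopology A) αbar ∧
    ∀ a : A, αbar (a : 𝓜(ℂ, A)) = (α a : 𝓜(ℂ, A))

/-- An endomorphism is extendible if it extends to a strictly continuous endomorphism of the
multiplier algebra (which need not be unital). -/
def IsExtendible (α : A →⋆ₙₐ[ℂ] A) : Prop :=
  ∃ αbar : 𝓜(ℂ, A) →⋆ₙₐ[ℂ] 𝓜(ℂ, A), IsStrictExtension α αbar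

/-- A homomorphism `π : A → B` is nondegenerate if `π(A)B` spans a dense subspace of `B`. -/
def IsNondegenerate (π : A →⋆ₙₐ[ℂ] B) : Prop :=
  Dense (Submodule.span ℂ {x : B | ∃ a b, x = π a * b} : Set B)

/-- A linear map between C⋆-algebras is positive if it maps positive elements, that is, elements
of the form `a* a`, to positive elements. -/
def IsPositive (L : A →ₗ[ℂ] B) : Prop :=
  ∀ a, ∃ b, L (star a * a) = star b * b

lemma mul_coe (m : 𝓜(ℂ, A)) (a : A) : m * (a : 𝓜(ℂ, A)) = (m.fst a : 𝓜(ℂ, A)) := by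
  have key : ∀ x y : A, m.fst (x * y) = m.fst x * y := by
    intro x y
    have h : ∀ z, z * m.fst (x * y) = z * (m.fst x * y) := fun z => by
      rw [← m.central, ← mul_assoc, m.central, mul_assoc]
    rw [← sub_eq_zero, ← CStarRing.star_mul_self_eq_zero_iff, mul_sub, h, sub_self]
  ext x
  · simp [key]
  · simp [m.central]

lemma coe_mul (m : 𝓜(ℂ, A)) (a : A) : (a : 𝓜(ℂ, A)) * m = (m.snd a : 𝓜(ℂ, A)) := by
  have key : ∀ x y : A, m.snd (x * y) = x * m.snd y := by
    intro x y
    have h : ∀ z, m.snd (x * y) * z = x * m.snd y * z := fun z => by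
      rw [m.central, mul_assoc, mul_assoc, m.central]
    rw [← sub_eq_zero, ← CStarRing.mul_star_self_eq_zero_iff, sub_mul, h, sub_self]
  ext x
  · simp [m.central]
  · simp [key]

lemma coe_mul_coe (a b : A) : (a : 𝓜(ℂ, A)) * (b : 𝓜(ℂ, A)) = ((a * b : A) : 𝓜(ℂ, A)) :=
  (map_mul (DoubleCentralizer.coeHom (𝕜 := ℂ) (A := A)) a b).symm

lemma star_coe (a : A) : star (a : 𝓜(ℂ, A)) = ((star a : A) : 𝓜(ℂ, A)) :=
  (map_star (DoubleCentralizer.coeHom (𝕜 := ℂ) (A := A)) a).symm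

lemma coe_injective : Function.Injective (fun a : A => (a : 𝓜(ℂ, A))) := by
  intro a b h
  have h' : ∀ x, a * x = b * x := fun x => by
    have := congrArg (fun m : 𝓜(ℂ, A) => m.fst x) h
    simpa using this
  rw [← sub_eq_zero, ← CStarRing.mul_star_self_eq_zero_iff, sub_mul, h', sub_self]

lemma fst_mul (m : 𝓜(ℂ, A)) (x y : A) : m.fst (x * y) = m.fst x * y := by
  apply coe_injective
  simp only [← mul_coe, ← coe_mul_coe, mul_assoc]

lemma snd_mul (m : 𝓜(ℂ, A)) (x y : A) : m.snd (x * y) = x * m.snd y := by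
  apply coe_injective
  simp only [← coe_mul, ← coe_mul_coe, mul_assoc]

lemma exists_approxUnit (A : Type*) [NonUnitalCStarAlgebra A] :
    ∃ l : Filter A, l.NeBot ∧ (∀ᶠ e in l, ‖e‖ ≤ 1 ∧ star e = e ∧
        ∀ z : A, ‖z - z * e‖ ≤ ‖z‖) ∧
      (∀ a, Tendsto (fun e => e * a) l (𝓝 a)) ∧ ∀ a, Tendsto (fun e => a * e) l (𝓝 a) := by
  let _ := CStarAlgebra.spectralOrder A
  let _ := CStarAlgebra.spectralOrderedRing A
  have h := CStarAlgebra.increasingApproximateUnit A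
  refine ⟨CStarAlgebra.approximateUnit A, h.neBot, ?_, h.tendsto_mul_right, h.tendsto_mul_left⟩
  filter_upwards [h.eventually_norm, h.eventually_nonneg, h.eventually_star_eq] with e h1 h2 h3
  refine ⟨h1, h3, fun z => ?_⟩
  have := CStarAlgebra.norm_sub_mul_self_le_of_inr (x := 0) (y := e) (star z) le_rfl h2 h1
    (norm_nonneg z) (by
      rw [Unitization.inr_zero, sub_zero, mul_one, CStarRing.norm_star_mul_self,
        Unitization.norm_inr, norm_star, sq])
  rw [← norm_star]
  simpa [h3] using this

/-- Strict completeness: a bounded strictly Cauchy family has a strict limit. -/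
lemma exists_strict_limit {ι : Type*} {l : Filter ι} [l.NeBot] {w : ι → B} {C : ℝ}
    (hw : ∀ᶠ e in l, ‖w e‖ ≤ C)
    (h1 : ∀ x, ∃ y, Tendsto (fun e => w e * x) l (𝓝 y))
    (h2 : ∀ x, ∃ y, Tendsto (fun e => x * w e) l (𝓝 y)) :
    ∃ m : 𝓜(ℂ, B), (∀ x, Tendsto (fun e => w e * x) l (𝓝 (m.fst x))) ∧
      ∀ x, Tendsto (fun e => x * w e) l (𝓝 (m.snd x)) := by
  choose f hf using h1
  choose g hg using h2
  have bf : ∀ x, ‖f x‖ ≤ C * ‖x‖ := fun x => le_of_tendsto (hf x).norm <| by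
    filter_upwards [hw] with e he
    exact (norm_mul_le _ _).trans (by gcongr)
  have bg : ∀ x, ‖g x‖ ≤ C * ‖x‖ := fun x => le_of_tendsto (hg x).norm <| by
    filter_upwards [hw] with e he
    exact (norm_mul_le _ _).trans (by rw [mul_comm]; gcongr)
  let F : B →ₗ[ℂ] B :=
    { toFun := f
      map_add' := fun x y => tendsto_nhds_unique (hf (x + y)) <| by
        simpa only [mul_add] using (hf x).add (hf y)
      map_smul' := fun c x => tendsto_nhds_unique (hf (c • x)) <| by
        simpa only [mul_smul_comm] using! (hf x).const_smul c }
  let G : B →ₗ[ℂ] B :=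
    { toFun := g
      map_add' := fun x y => tendsto_nhds_unique (hg (x + y)) <| by
        simpa only [add_mul] using (hg x).add (hg y)
      map_smul' := fun c x => tendsto_nhds_unique (hg (c • x)) <| by
        simpa only [smul_mul_assoc] using! (hg x).const_smul c }
  refine ⟨⟨(F.mkContinuous C bf, G.mkContinuous C bg), fun x y => ?_⟩, hf, hg⟩
  refine tendsto_nhds_unique ((hg x).mul_const y) ?_
  simp only [mul_assoc]
  exact (hf y).const_mul x

end Multipliers

/-- An Exel system `(A, α, L)`: an extendible endomorphism `α` and a transfer operator `L`, that
is, a positive linear map that extends to a positive linear map `Lbar` on `M(A)` such that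
`L(α(a) m) = a Lbar(m)` and `Lbar(1) = 1`. -/
structure ExelSystem (A : Type u) [NonUnitalCStarAlgebra A] where
  /-- the endomorphism -/
  α : A →⋆ₙₐ[ℂ] A
  /-- the transfer operator -/
  L : A →ₗ[ℂ] A
  extendible : IsExtendible α
  positive : IsPositive L
  transfer : ∃ Lbar : 𝓜(ℂ, A) →ₗ[ℂ] 𝓜(ℂ, A), IsPositive Lbar ∧
    (∀ a : A, Lbar (a : 𝓜(ℂ, A)) = (L a : 𝓜(ℂ, A))) ∧
    (∀ (a : A) (m : 𝓜(ℂ, A)), L (m.snd (α a)) = (Lbar m).snd a) ∧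
    Lbar 1 = 1

namespace ExelSystem

variable {A : Type u} [NonUnitalCStarAlgebra A] (S : ExelSystem A)

/-! ### The right-Hilbert bimodule `M_L` -/

lemma L_alpha_mul (a x : A) : S.L (S.α a * x) = a * S.L x := by
  obtain ⟨Lbar, -, h1, h2, -⟩ := S.transfer
  have := h2 a (x : 𝓜(ℂ, A))
  rw [h1] at this
  simpa using this

lemma star_L (x y : A) : star (S.L (star x * y)) = S.L (star y * x) := by
  have sa : ∀ z, star (S.L (star z * z)) = S.L (star z * z) := fun z => by
    obtain ⟨b, hb⟩ := S.positive z
    rw [hb, star_mul, star_star]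
  have h1 := sa (x + y)
  have h2 := sa (x + Complex.I • y)
  have hx := sa x
  have hy := sa y
  simp only [star_add, star_smul, add_mul, mul_add, map_add, smul_mul_assoc, mul_smul_comm,
    map_smul, hx, hy] at h1 h2
  have e1 : star (S.L (star x * y)) + star (S.L (star y * x)) =
      S.L (star x * y) + S.L (star y * x) := by
    have := sub_eq_zero.mpr h1
    rw [← sub_eq_zero, ← this]; abel
  have e2 : star (S.L (star x * y)) - star (S.L (star y * x)) =
      S.L (star y * x) - S.L (star x * y) := by
    simp only [Complex.star_def, Complex.conj_I, map_neg, neg_neg, neg_smul, smul_add,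
      smul_neg] at h2
    apply smul_right_injective A Complex.I_ne_zero
    have := sub_eq_zero.mpr h2
    simp only [smul_sub]
    rw [← sub_eq_zero, ← neg_eq_zero, ← this]
    abel
  have h4 : (2 : ℂ) • star (S.L (star x * y)) = (2 : ℂ) • S.L (star y * x) := by
    have := congrArg₂ (fun a b => a + b) e1 e2
    simp only [two_smul]
    rw [← sub_eq_zero] at this ⊢
    rw [← this]
    abel
  exact smul_right_injective A (two_ne_zero (α := ℂ)) h4

lemma L_mul_alpha (x y b : A) : S.L (star x * (y * S.α b)) = S.L (star x * y) * b := by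
  rw [← star_L, star_mul, mul_assoc, ← map_star S.α, L_alpha_mul, star_mul, star_star, star_L]

lemma norm_L_le_of_bound {x y : A} {c : ℝ} (hc : 0 ≤ c)
    (h : ∃ z, c • (star y * y) - star x * x = star z * z) :
    ‖S.L (star x * x)‖ ≤ c * ‖S.L (star y * y)‖ := by
  let _ := CStarAlgebra.spectralOrder A
  let _ := CStarAlgebra.spectralOrderedRing A
  obtain ⟨z, hz⟩ := h
  obtain ⟨w, hw⟩ := S.positive z
  obtain ⟨v, hv⟩ := S.positive x
  have h1 : S.L (star x * x) ≤ c • S.L (star y * y) := by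
    rw [← sub_nonneg]
    have : S.L (c • (star y * y)) = c • S.L (star y * y) := by
      simpa only [Complex.coe_smul] using map_smul S.L (c : ℂ) (star y * y)
    rw [← this, ← map_sub, hz, hw]
    exact star_mul_self_nonneg w
  have h0 : 0 ≤ S.L (star x * x) := hv ▸ star_mul_self_nonneg v
  refine (CStarAlgebra.norm_le_norm_of_nonneg_of_le h0 h1).trans ?_
  rw [norm_smul, Real.norm_of_nonneg hc]

lemma norm_L_left (a x : A) :
    ‖S.L (star (a * x) * (a * x))‖ ≤ ‖a‖ ^ 2 * ‖S.L (star x * x)‖ := by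
  apply S.norm_L_le_of_bound (sq_nonneg _)
  let _ := CStarAlgebra.spectralOrder A
  let _ := CStarAlgebra.spectralOrderedRing A
  have : star x * (star a * a) * x ≤ ‖star a * a‖ • (star x * x) :=
    CStarAlgebra.star_left_conjugate_le_norm_smul (IsSelfAdjoint.star_mul_self a)
  rw [CStarRing.norm_star_mul_self, ← sq, ← sub_nonneg] at this
  rw [star_mul, mul_assoc, ← mul_assoc (star a), ← mul_assoc]
  obtain ⟨z, hz⟩ := CStarAlgebra.nonneg_iff_eq_star_mul_self.mp this
  exact ⟨z, hz⟩

lemma norm_L_le (a : A) : ‖S.L (star a * a)‖ ≤ ‖a‖ ^ 2 := by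
  obtain ⟨Lbar, hpos, h1, -, h3⟩ := S.transfer
  let _ := CStarAlgebra.spectralOrder 𝓜(ℂ, A)
  let _ := CStarAlgebra.spectralOrderedRing 𝓜(ℂ, A)
  have hn : ∀ x : A, ‖(x : 𝓜(ℂ, A))‖ = ‖x‖ := fun x =>
    NonUnitalStarAlgHom.norm_map (DoubleCentralizer.coeHom (𝕜 := ℂ) (A := A)) coe_injective x
  have h4 : ((star a * a : A) : 𝓜(ℂ, A)) ≤ ‖(a : 𝓜(ℂ, A))‖ ^ 2 • (1 : 𝓜(ℂ, A)) := by
    rw [← coe_mul_coe, ← star_coe, sq, ← CStarRing.norm_star_mul_self,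
      ← Algebra.algebraMap_eq_smul_one]
    exact IsSelfAdjoint.le_algebraMap_norm_self (.star_mul_self _)
  rw [hn, ← sub_nonneg] at h4
  obtain ⟨z, hz⟩ := CStarAlgebra.nonneg_iff_eq_star_mul_self.mp h4
  obtain ⟨w, hw⟩ := hpos z
  obtain ⟨v, hv⟩ := S.positive a
  have h5 : (S.L (star a * a) : 𝓜(ℂ, A)) ≤ ‖a‖ ^ 2 • (1 : 𝓜(ℂ, A)) := by
    have e : Lbar (‖a‖ ^ 2 • (1 : 𝓜(ℂ, A))) = ‖a‖ ^ 2 • (1 : 𝓜(ℂ, A)) := by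
      have := map_smul Lbar ((‖a‖ ^ 2 : ℝ) : ℂ) 1
      rw [h3] at this
      simpa only [Complex.coe_smul] using this
    rw [← h1, ← sub_nonneg]
    nth_rw 1 [← e]
    rw [← map_sub, hz, hw]
    exact star_mul_self_nonneg w
  have h0 : 0 ≤ (S.L (star a * a) : 𝓜(ℂ, A)) := by
    rw [hv, ← coe_mul_coe, ← star_coe]; exact star_mul_self_nonneg _
  have h6 := CStarAlgebra.norm_le_norm_of_nonneg_of_le h0 h5
  rw [hn] at h6
  refine h6.trans ?_
  rw [norm_smul, norm_pow, norm_norm]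
  have : ‖(1 : 𝓜(ℂ, A))‖ ≤ 1 := by
    rcases subsingleton_or_nontrivial 𝓜(ℂ, A) with h | h
    · simp [Subsingleton.elim (1 : 𝓜(ℂ, A)) 0]
    · simp
  nlinarith [sq_nonneg ‖a‖]

/-- Cauchy–Schwarz. -/
lemma norm_L_sq_le (x y : A) :
    ‖S.L (star x * y)‖ ^ 2 ≤ ‖S.L (star x * x)‖ * ‖S.L (star y * y)‖ := by
  let _ := CStarAlgebra.spectralOrder A
  let _ := CStarAlgebra.spectralOrderedRing A
  set N := ‖S.L (star x * x)‖ with hN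
  set a := S.L (star x * y) with ha
  have hxx : IsSelfAdjoint (S.L (star x * x)) := S.star_L x x
  have main : ∀ c : ℝ, N < c → ‖a‖ ^ 2 ≤ c * ‖S.L (star y * y)‖ := by
    intro c hc
    have hc0 : 0 < c := (norm_nonneg _).trans_lt hc
    obtain ⟨b, hb⟩ := S.positive (x * S.α a - (c : ℂ) • y)
    have e : S.L (star (x * S.α a - (c : ℂ) • y) * (x * S.α a - (c : ℂ) • y)) =
        star a * S.L (star x * x) * a - (2 * c) • (star a * a)
          + (c * c) • S.L (star y * y) := by
      have h1 : S.L (star (x * S.α a) * (x * S.α a)) = star a * S.L (star x * x) * a := by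
        rw [L_mul_alpha, ← S.star_L x, L_mul_alpha, star_mul, S.star_L x x]
      have h2 : S.L (star (x * S.α a) * y) = star a * a := by
        rw [← star_L, L_mul_alpha, star_mul, ← S.star_L x y, star_star]
      have h3 : S.L (star y * (x * S.α a)) = star a * a := by
        rw [L_mul_alpha, ← star_L]
      rw [star_sub, sub_mul, mul_sub, mul_sub, star_smul]
      simp only [smul_mul_assoc, mul_smul_comm, map_sub, map_smul, h1, h2, h3]
      simp only [Complex.star_def, Complex.conj_ofReal, Complex.coe_smul, smul_smul, two_mul,
        add_smul]
      abel
    have h0 : 0 ≤ star a * S.L (star x * x) * a - (2 * c) • (star a * a)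
          + (c * c) • S.L (star y * y) := by
      rw [← e, hb]; exact star_mul_self_nonneg b
    have h1 : star a * S.L (star x * x) * a ≤ c • (star a * a) :=
      (CStarAlgebra.star_left_conjugate_le_norm_smul hxx).trans
        (smul_le_smul_of_nonneg_right hc.le (star_mul_self_nonneg a))
    have h2 : c • (star a * a) ≤ c • (c • S.L (star y * y)) := by
      rw [← sub_nonneg]
      refine h0.trans ?_
      rw [← sub_nonneg]
      have : c • (c • S.L (star y * y)) - c • (star a * a) -
          (star a * S.L (star x * x) * a - (2 * c) • (star a * a) + (c * c) • S.L (star y * y))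
          = c • (star a * a) - star a * S.L (star x * x) * a := by
        simp only [smul_smul, two_mul, add_smul]; abel
      rw [this]
      exact sub_nonneg.mpr h1
    have h3 := CStarAlgebra.norm_le_norm_of_nonneg_of_le
      (smul_nonneg hc0.le (star_mul_self_nonneg a)) h2
    rw [norm_smul, norm_smul, norm_smul, Real.norm_of_nonneg hc0.le,
      CStarRing.norm_star_mul_self, ← sq] at h3
    exact le_of_mul_le_mul_left h3 hc0
  refine le_of_forall_gt_imp_ge_of_dense ?_ |>.trans le_rfl
  intro d hd
  by_contra hlt
  push Not at hlt
  have hlim : Tendsto (fun c : ℝ => c * ‖S.L (star y * y)‖) (𝓝[>] N)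
      (𝓝 (N * ‖S.L (star y * y)‖)) :=
    ((continuous_id.mul continuous_const).tendsto N).mono_left nhdsWithin_le_nhds
  have := ge_of_tendsto hlim (Filter.eventually_of_mem self_mem_nhdsWithin main)
  linarith

end ExelSystem
namespace ExelSystem

variable {A : Type u} [NonUnitalCStarAlgebra A] (S : ExelSystem A)

/-- The vector space `A`, to be equipped with the seminorm `‖a‖ = ‖L(a* a)‖^(1/2)` of the
pre-inner product `⟨a, b⟩ = L(a* b)`. -/
def PreModule (_ : ExelSystem A) : Type u := A

instance : AddCommGroup S.PreModule := inferInstanceAs (AddCommGroup A)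

instance : Module ℂ S.PreModule := inferInstanceAs (Module ℂ A)

/-- The identity map `A → S.PreModule`. -/
def toPre : A →ₗ[ℂ] S.PreModule := LinearMap.id (M := A)

/-- The identity map `S.PreModule → A`. -/
def ofPre : S.PreModule →ₗ[ℂ] A := LinearMap.id (M := A)

instance : Norm S.PreModule where
  norm x := Real.sqrt ‖S.L (star (S.ofPre x) * S.ofPre x)‖

lemma pre_norm_def (x : S.PreModule) :
    ‖x‖ = Real.sqrt ‖S.L (star (S.ofPre x) * S.ofPre x)‖ := rfl

lemma norm_L_inner (x y : S.PreModule) :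
    ‖S.L (star (S.ofPre x) * S.ofPre y)‖ ≤ ‖x‖ * ‖y‖ := by
  rw [pre_norm_def, pre_norm_def, ← Real.sqrt_mul (norm_nonneg _)]
  exact Real.le_sqrt_of_sq_le (S.norm_L_sq_le _ _)

lemma preModule_core : SeminormedSpace.Core ℂ S.PreModule where
  norm_nonneg x := Real.sqrt_nonneg _
  norm_smul c x := by
    simp only [pre_norm_def, map_smul, star_smul, smul_mul_assoc, mul_smul_comm, norm_smul,
      norm_star]
    rw [← mul_assoc, Real.sqrt_mul (by positivity), Real.sqrt_mul_self (norm_nonneg c)]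
  norm_triangle x y := by
    have hx : 0 ≤ ‖x‖ := Real.sqrt_nonneg _
    have hy : 0 ≤ ‖y‖ := Real.sqrt_nonneg _
    rw [pre_norm_def]
    refine Real.sqrt_le_iff.mpr ⟨by positivity, ?_⟩
    have e : ∀ z : S.PreModule, ‖S.L (star (S.ofPre z) * S.ofPre z)‖ = ‖z‖ * ‖z‖ := fun z => by
      rw [pre_norm_def, Real.mul_self_sqrt (norm_nonneg _)]
    simp only [map_add, star_add, add_mul, mul_add]
    calc _ ≤ (‖S.L (star (S.ofPre x) * S.ofPre x)‖ + ‖S.L (star (S.ofPre y) * S.ofPre x)‖)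
            + (‖S.L (star (S.ofPre x) * S.ofPre y)‖ + ‖S.L (star (S.ofPre y) * S.ofPre y)‖) :=
          (norm_add_le _ _).trans (add_le_add (norm_add_le _ _) (norm_add_le _ _))
      _ ≤ _ := by
          rw [e, e]
          nlinarith [S.norm_L_inner x y, S.norm_L_inner y x]

instance : SeminormedAddCommGroup S.PreModule := .ofCore S.preModule_core

instance : NormedSpace ℂ S.PreModule where
  norm_smul_le c x := (S.preModule_core.norm_smul c x).le

/-- The Hilbert bimodule `M_L`: the Hausdorff completion of `A` for the seminorm
`‖a‖ = ‖L(a* a)‖^(1/2)`. -/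
abbrev ML : Type u := UniformSpace.Completion S.PreModule

/-- The canonical map `q : A → M_L`. -/
def q : A →ₗ[ℂ] S.ML :=
  (UniformSpace.Completion.toComplL (𝕜 := ℂ) (E := S.PreModule)).toLinearMap ∘ₗ S.toPre

lemma norm_q (a : A) : ‖S.q a‖ = Real.sqrt ‖S.L (star a * a)‖ :=
  UniformSpace.Completion.norm_coe (S.toPre a)

lemma norm_q_sq (a : A) : ‖S.q a‖ ^ 2 = ‖S.L (star a * a)‖ := by
  rw [norm_q, Real.sq_sqrt (norm_nonneg _)]

lemma norm_q_le (a : A) : ‖S.q a‖ ≤ ‖a‖ := by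
  rw [norm_q]
  exact Real.sqrt_le_iff.mpr ⟨norm_nonneg _, S.norm_L_le a⟩

lemma denseRange_q : DenseRange S.q :=
  UniformSpace.Completion.denseRange_coe (α := S.PreModule)

/-- The left action: `S.leftAction a` is the operator `φ(a)` on `M_L` with
`φ(a) q(b) = q(ab)`. -/
def leftAction (a : A) : S.ML →L[ℂ] S.ML :=
  (S.q ∘ₗ LinearMap.mulLeft ℂ a).extendOfNorm S.q

lemma leftAction_q (a b : A) : S.leftAction a (S.q b) = S.q (a * b) := by
  refine LinearMap.extendOfNorm_eq S.denseRange_q ⟨‖a‖, fun x => ?_⟩ b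
  change ‖S.q (a * x)‖ ≤ _
  refine abs_le_of_sq_le_sq' ?_ (by positivity) |>.2
  rw [mul_pow, norm_q_sq, norm_q_sq]
  exact S.norm_L_left a x

lemma norm_q_mul_alpha_le (a b : A) : ‖S.q (a * S.α b)‖ ≤ ‖S.q a‖ * ‖b‖ := by
  refine abs_le_of_sq_le_sq' ?_ (by positivity) |>.2
  rw [mul_pow, norm_q_sq, norm_q_sq, L_mul_alpha, ← star_L, L_mul_alpha, star_mul, star_L]
  calc _ ≤ ‖star b‖ * ‖S.L (star a * a)‖ * ‖b‖ :=
        (norm_mul_le _ _).trans (by gcongr; exact norm_mul_le _ _)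
    _ = _ := by rw [norm_star]; ring

/-- `b ↦ m · b` for `m = q(a)`; here `q(a) · b = q(a α(b))`. -/
def rightActionAux : A →ₗ[ℂ] A →L[ℂ] S.ML where
  toFun a := LinearMap.mkContinuous
    { toFun := fun b => S.q (a * S.α b)
      map_add' := fun _ _ => by rw [map_add, mul_add, map_add]
      map_smul' := fun _ _ => by rw [map_smul, mul_smul_comm, map_smul, RingHom.id_apply] }
    ‖S.q a‖ (S.norm_q_mul_alpha_le a)
  map_add' a b := by ext x; simp [add_mul]
  map_smul' c a := by ext x; simp [smul_mul_assoc]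

lemma rightActionAux_apply (a b : A) : S.rightActionAux a b = S.q (a * S.α b) := rfl

lemma norm_rightActionAux_le (a : A) : ‖S.rightActionAux a‖ ≤ 1 * ‖S.q a‖ := by
  rw [one_mul]
  exact ContinuousLinearMap.opNorm_le_bound _ (norm_nonneg _) (S.norm_q_mul_alpha_le a)

/-- The right action: `S.rightAction m b = m · b`. -/
def rightAction : S.ML →L[ℂ] A →L[ℂ] S.ML := S.rightActionAux.extendOfNorm S.q

lemma rightAction_q (a b : A) : S.rightAction (S.q a) b = S.q (a * S.α b) := by
  rw [rightAction, LinearMap.extendOfNorm_eq S.denseRange_q ⟨1, S.norm_rightActionAux_le⟩,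
    rightActionAux_apply]

/-- `n ↦ ⟨q(a), n⟩`. -/
def innerAux (a : A) : S.ML →L[ℂ] A :=
  (S.L ∘ₗ LinearMap.mulLeft ℂ (star a)).extendOfNorm S.q

lemma innerAux_bound (a x : A) :
    ‖(S.L ∘ₗ LinearMap.mulLeft ℂ (star a)) x‖ ≤ ‖S.q a‖ * ‖S.q x‖ := by
  have := S.norm_L_inner (S.toPre a) (S.toPre x)
  rw [norm_q, norm_q]
  exact this

lemma innerAux_q (a b : A) : S.innerAux a (S.q b) = S.L (star a * b) :=
  LinearMap.extendOfNorm_eq S.denseRange_q ⟨_, S.innerAux_bound a⟩ b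

lemma ext_q {F : Type*} [TopologicalSpace F] [AddCommMonoid F] [T2Space F] [Module ℂ F]
    {f g : S.ML →L[ℂ] F} (h : ∀ a, f (S.q a) = g (S.q a)) : f = g :=
  ContinuousLinearMap.coeFn_injective <|
    S.denseRange_q.equalizer f.continuous g.continuous (funext h)

/-- `innerAux` as a conjugate-linear map. -/
def innerAux' : A →ₗ⋆[ℂ] S.ML →L[ℂ] A where
  toFun := S.innerAux
  map_add' a b := S.ext_q fun x => by simp [innerAux_q, add_mul]
  map_smul' c a := S.ext_q fun x => by simp [innerAux_q, smul_mul_assoc]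

/-- The `A`-valued inner product of `M_L`, conjugate-linear in the first variable. -/
def inner : S.ML →L⋆[ℂ] S.ML →L[ℂ] A := S.innerAux'.extendOfNorm S.q

lemma inner_q_q (a b : A) : S.inner (S.q a) (S.q b) = S.L (star a * b) := by
  rw [inner, LinearMap.extendOfNorm_eq S.denseRange_q ⟨1, fun a => ?_⟩]
  · exact S.innerAux_q a b
  · rw [one_mul]
    exact LinearMap.opNorm_extendOfNorm_le S.denseRange_q (norm_nonneg _) (S.innerAux_bound a)

/-- The rank-one operator `Θ_{m,n} : p ↦ m · ⟨n, p⟩`. -/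
def rankOne (m n : S.ML) : S.ML →L[ℂ] S.ML := (S.rightAction m).comp (S.inner n)

/-- The algebra `K(M_L)` of compact operators: the closed span of the rank-one operators. -/
def compacts : Submodule ℂ (S.ML →L[ℂ] S.ML) :=
  (Submodule.span ℂ {k | ∃ m n, k = S.rankOne m n}).topologicalClosure

/-- The ideal `K_α`: the intersection of the closed ideal `A α(A) A` of `A` (the closed span of
the products) with `φ⁻¹(K(M_L))`. -/
def Kα : Set A :=
  {a | a ∈ (Submodule.span ℂ {x : A | ∃ b c d, x = b * S.α c * d}).topologicalClosure ∧
    S.leftAction a ∈ S.compacts}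

end ExelSystem

section Generated

variable {B : Type*} [NonUnitalCStarAlgebra B]

/-- The C⋆-algebra `B` is generated by the set `s`. -/
def IsGeneratedBy (s : Set B) : Prop :=
  (NonUnitalStarAlgebra.adjoin ℂ s).topologicalClosure = ⊤

lemma IsGeneratedBy.mem_of_right_ideal {s : Set B} (hs : IsGeneratedBy s) (D : Submodule ℂ B)
    (hD : IsClosed (D : Set B)) (h1 : ∀ x ∈ s, x ∈ D) (h2 : ∀ x ∈ s, star x ∈ D)
    (hmul : ∀ x ∈ D, ∀ y, x * y ∈ D) (x : B) : x ∈ D := by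
  have h : (NonUnitalStarAlgebra.adjoin ℂ s : Set B) ⊆ D := by
    intro y hy
    refine NonUnitalAlgebra.adjoin_induction (s := s ∪ star s) (p := fun y _ => y ∈ D)
      ?_ (fun _ _ _ _ => D.add_mem) D.zero_mem (fun a b _ _ ha _ => hmul a ha b)
      (fun c _ _ => D.smul_mem c) hy
    rintro z (hz | hz)
    · exact h1 z hz
    · simpa using h2 _ hz
  have hx : x ∈ (NonUnitalStarAlgebra.adjoin ℂ s).topologicalClosure := hs ▸ trivial
  exact closure_minimal h hD hx

lemma exists_tendsto_of_dense {ι : Type*} {l : Filter ι} [l.NeBot] (f : ι → B →ₗ[ℂ] B)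
    (hf : ∀ᶠ e in l, ∀ x, ‖f e x‖ ≤ ‖x‖) {s : Set B} (hs : Dense s)
    (h : ∀ x ∈ s, ∃ y, Tendsto (fun e => f e x) l (𝓝 y)) (x : B) :
    ∃ y, Tendsto (fun e => f e x) l (𝓝 y) := by
  rw [← cauchy_map_iff_exists_tendsto, Metric.cauchy_iff]
  refine ⟨inferInstance, fun ε hε => ?_⟩
  obtain ⟨x', hx', hd⟩ := Metric.mem_closure_iff.mp (hs x) (ε / 4) (by positivity)
  obtain ⟨y, hy⟩ := h x' hx'
  refine ⟨Metric.ball y (ε / 2), ?_, fun a ha b hb => ?_⟩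
  · rw [mem_map]
    filter_upwards [hf, Metric.tendsto_nhds.mp hy (ε / 4) (by positivity)] with e h1 h2
    have h3 := h1 (x - x')
    rw [map_sub, ← dist_eq_norm, ← dist_eq_norm] at h3
    exact (dist_triangle _ (f e x') _).trans_lt (by linarith)
  · exact (dist_triangle_right a b y).trans_lt (by
      rw [Metric.mem_ball] at ha hb; linarith)

end Generated

section Toeplitz

variable {A : Type u} [NonUnitalCStarAlgebra A]

/-- A Toeplitz-covariant representation of an Exel system in a C⋆-algebra `B`. -/
structure ToeplitzRep (S : ExelSystem A) (B : Type*) [NonUnitalCStarAlgebra B] where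
  /-- the representation of `A` -/
  π : A →⋆ₙₐ[ℂ] B
  nondegenerate : IsNondegenerate π
  /-- the multiplier -/
  V : 𝓜(ℂ, B)
  covariant : ∀ a, V * (π a : 𝓜(ℂ, B)) = (π (S.α a) : 𝓜(ℂ, B)) * V
  transfer : ∀ a, star V * (π a : 𝓜(ℂ, B)) * V = (π (S.L a) : 𝓜(ℂ, B))

namespace ToeplitzRep

variable {S : ExelSystem A} {B : Type*} [NonUnitalCStarAlgebra B] (ρ : ToeplitzRep S B)

/-- The element `π(a) V` of `B`. -/
def w (a : A) : B := ρ.V.snd (ρ.π a)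

lemma coe_w (a : A) : (ρ.w a : 𝓜(ℂ, B)) = (ρ.π a : 𝓜(ℂ, B)) * ρ.V := (coe_mul _ _).symm

lemma π_mul_w (a b : A) : ρ.π a * ρ.w b = ρ.w (a * b) := by
  rw [w, w, map_mul, snd_mul]

lemma w_mul_π (a b : A) : ρ.w a * ρ.π b = ρ.w (a * S.α b) := by
  apply coe_injective
  simp only [← coe_mul_coe, coe_w, mul_assoc, ρ.covariant, map_mul]

lemma star_w_mul_w (a b : A) : star (ρ.w a) * ρ.w b = ρ.π (S.L (star a * b)) := by
  apply coe_injective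
  simp only [← coe_mul_coe, coe_w, ← star_coe, star_mul, ← ρ.transfer, map_mul, map_star, mul_assoc]

lemma norm_w_le (a : A) : ‖ρ.w a‖ ≤ ‖S.q a‖ := by
  refine abs_le_of_sq_le_sq' ?_ (norm_nonneg _) |>.2
  rw [S.norm_q_sq, sq, ← CStarRing.norm_star_mul_self, star_w_mul_w]
  exact NonUnitalStarAlgHom.norm_apply_le _ _

end ToeplitzRep

/-- Formal ⋆-polynomials in the symbols `i(a)` and `w(a) = i(a)s`, for `a : A`. -/
inductive Poly (A : Type u) : Type u
  | i (a : A) : Poly A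
  | w (a : A) : Poly A
  | add (x y : Poly A) : Poly A
  | mul (x y : Poly A) : Poly A
  | smul (c : ℂ) (x : Poly A) : Poly A
  | star (x : Poly A) : Poly A

/-- Evaluation of a ⋆-polynomial. -/
def Poly.eval {B : Type*} [NonUnitalCStarAlgebra B] (f g : A → B) : Poly A → B
  | .i a => f a
  | .w a => g a
  | .add x y => x.eval f g + y.eval f g
  | .mul x y => x.eval f g * y.eval f g
  | .smul c x => c • x.eval f g
  | .star x => Star.star (x.eval f g)

namespace ExelSystem

variable (S : ExelSystem A)

/-- The C⋆-seminorms on the ⋆-polynomials that come from Toeplitz-covariant representations. They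
index a set of representations that contains, up to isomorphism of the C⋆-algebras generated, every
Toeplitz-covariant representation. -/
def RepIndex : Type u :=
  {p : Poly A → ℝ // ∃ (B : Type u) (_ : NonUnitalCStarAlgebra B) (ρ : ToeplitzRep S B),
    ∀ x, p x = ‖x.eval ρ.π ρ.w‖}

/-- The algebra of a representation with a given seminorm. -/
def RepAlg (p : S.RepIndex) : Type u := p.2.choose

instance (p : S.RepIndex) : NonUnitalCStarAlgebra (S.RepAlg p) := p.2.choose_spec.choose

/-- A representation with a given seminorm. -/
def rep (p : S.RepIndex) : ToeplitzRep S (S.RepAlg p) := p.2.choose_spec.choose_spec.choose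

lemma rep_spec (p : S.RepIndex) (x : Poly A) :
    p.1 x = ‖x.eval (S.rep p).π (S.rep p).w‖ :=
  p.2.choose_spec.choose_spec.choose_spec x

/-- The `ℓ^∞` direct sum of the representing algebras. -/
abbrev BigAlg : Type u := lp S.RepAlg ⊤

/-- The direct sum of the elements `π(a)`. -/
def bigI (a : A) : S.BigAlg :=
  ⟨fun p => (S.rep p).π a, memℓp_infty ⟨‖a‖, by
    rintro _ ⟨p, rfl⟩; exact NonUnitalStarAlgHom.norm_apply_le _ _⟩⟩

/-- The direct sum of the elements `π(a) V`. -/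
def bigW (a : A) : S.BigAlg :=
  ⟨fun p => (S.rep p).w a, memℓp_infty ⟨‖S.q a‖, by
    rintro _ ⟨p, rfl⟩; exact (S.rep p).norm_w_le a⟩⟩

/-- The C⋆-subalgebra generated by the `bigI a` and `bigW a`. -/
def toeplitzSubalgebra : NonUnitalStarSubalgebra ℂ S.BigAlg :=
  (NonUnitalStarAlgebra.adjoin ℂ (Set.range S.bigI ∪ Set.range S.bigW)).topologicalClosure

instance : IsClosed (S.toeplitzSubalgebra : Set S.BigAlg) :=
  NonUnitalStarSubalgebra.isClosed_topologicalClosure _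

/-- The Toeplitz crossed product `T(A, α, L)`. Its universal property is `toeplitz_universal`. -/
def ToeplitzAlg : Type u := S.toeplitzSubalgebra

instance : NonUnitalCStarAlgebra S.ToeplitzAlg :=
  inferInstanceAs (NonUnitalCStarAlgebra S.toeplitzSubalgebra)

/-- The inclusion of the Toeplitz crossed product in the direct sum. -/
def toBig : S.ToeplitzAlg →⋆ₙₐ[ℂ] S.BigAlg :=
  NonUnitalStarSubalgebraClass.subtype S.toeplitzSubalgebra

lemma toBig_injective : Function.Injective S.toBig := Subtype.val_injective

lemma norm_toBig (x : S.ToeplitzAlg) : ‖S.toBig x‖ = ‖x‖ := rfl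

lemma bigI_mem (a : A) : S.bigI a ∈ S.toeplitzSubalgebra :=
  NonUnitalStarSubalgebra.le_topologicalClosure _
    (NonUnitalStarAlgebra.subset_adjoin ℂ _ (.inl ⟨a, rfl⟩))

lemma bigW_mem (a : A) : S.bigW a ∈ S.toeplitzSubalgebra :=
  NonUnitalStarSubalgebra.le_topologicalClosure _
    (NonUnitalStarAlgebra.subset_adjoin ℂ _ (.inr ⟨a, rfl⟩))

/-- The canonical homomorphism `i : A → T(A, α, L)`. -/
def i : A →⋆ₙₐ[ℂ] S.ToeplitzAlg where
  toFun a := (⟨S.bigI a, S.bigI_mem a⟩ : S.toeplitzSubalgebra)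
  map_smul' c a := Subtype.ext <| lp.ext <| funext fun p => map_smul (S.rep p).π c a
  map_zero' := Subtype.ext <| lp.ext <| funext fun p => map_zero (S.rep p).π
  map_add' a b := Subtype.ext <| lp.ext <| funext fun p => map_add (S.rep p).π a b
  map_mul' a b := Subtype.ext <| lp.ext <| funext fun p => map_mul (S.rep p).π a b
  map_star' a := Subtype.ext <| lp.ext <| funext fun p => map_star (S.rep p).π a

/-- The elements `w(a)` of `T(A, α, L)`, equal to `i(a)s` by `coe_w` below. -/
def w (a : A) : S.ToeplitzAlg := (⟨S.bigW a, S.bigW_mem a⟩ : S.toeplitzSubalgebra)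

lemma toBig_i (a : A) (p : S.RepIndex) : S.toBig (S.i a) p = (S.rep p).π a := rfl

lemma toBig_w (a : A) (p : S.RepIndex) : S.toBig (S.w a) p = (S.rep p).w a := rfl

lemma ext_big {x y : S.ToeplitzAlg} (h : ∀ p, S.toBig x p = S.toBig y p) : x = y :=
  S.toBig_injective <| lp.ext <| funext h

lemma generated_i_w : IsGeneratedBy (Set.range S.i ∪ Set.range S.w) := by
  refine top_le_iff.mp fun x _ => ?_
  have hx : S.toBig x ∈ S.toeplitzSubalgebra := x.2
  change x ∈ closure _
  rw [(Isometry.isEmbedding (f := S.toBig) (AddMonoidHomClass.isometry_of_norm _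
    S.norm_toBig)).isInducing.closure_eq_preimage_closure_image]
  have e := NonUnitalStarAlgHom.map_adjoin (R := ℂ) S.toBig (Set.range S.i ∪ Set.range S.w)
  rw [Set.image_union, ← Set.range_comp, ← Set.range_comp] at e
  change S.toBig x ∈ closure (S.toBig '' _)
  have e' : S.toBig '' (NonUnitalStarAlgebra.adjoin ℂ (Set.range S.i ∪ Set.range S.w) :
      Set S.ToeplitzAlg) = (NonUnitalStarAlgebra.adjoin ℂ (Set.range S.bigI ∪ Set.range S.bigW) :
      Set S.BigAlg) := congrArg (fun K : NonUnitalStarSubalgebra ℂ S.BigAlg => (K : Set S.BigAlg)) e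
  rw [e']
  exact hx

lemma i_mul_w (a b : A) : S.i a * S.w b = S.w (a * b) :=
  S.ext_big fun p => (S.rep p).π_mul_w a b

lemma w_mul_i (a b : A) : S.w a * S.i b = S.w (a * S.α b) :=
  S.ext_big fun p => (S.rep p).w_mul_π a b

lemma star_w_mul_w (a b : A) : star (S.w a) * S.w b = S.i (S.L (star a * b)) :=
  S.ext_big fun p => (S.rep p).star_w_mul_w a b

/-- `w` as a linear map. -/
def wₗ : A →ₗ[ℂ] S.ToeplitzAlg where
  toFun := S.w
  map_add' a b := S.ext_big fun p => by
    simp [toBig_w, ToeplitzRep.w, map_add]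
  map_smul' c a := S.ext_big fun p => by
    simp [toBig_w, ToeplitzRep.w, map_smul]

lemma norm_w_le_q (a : A) : ‖S.w a‖ ≤ ‖S.q a‖ := by
  refine abs_le_of_sq_le_sq' ?_ (norm_nonneg _) |>.2
  rw [S.norm_q_sq, sq, ← CStarRing.norm_star_mul_self, star_w_mul_w]
  exact NonUnitalStarAlgHom.norm_apply_le _ _

lemma norm_w_le (a : A) : ‖S.w a‖ ≤ ‖a‖ := (S.norm_w_le_q a).trans (S.norm_q_le a)

lemma continuous_w : Continuous S.w :=
  (S.wₗ.mkContinuous 1 fun a => by rw [one_mul]; exact S.norm_w_le a).continuous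

lemma continuous_i : Continuous S.i :=
  AddMonoidHomClass.continuous_of_bound S.i 1 fun a => by
    rw [one_mul]; exact NonUnitalStarAlgHom.norm_apply_le _ _

lemma tendsto_i_mul {l : Filter A} (hb : ∀ᶠ e in l, ‖e‖ ≤ 1 ∧ star e = e ∧
      ∀ z : A, ‖z - z * e‖ ≤ ‖z‖)
    (hl : ∀ a, Tendsto (fun e => e * a) l (𝓝 a)) (hr : ∀ a, Tendsto (fun e => a * e) l (𝓝 a))
    (x : S.ToeplitzAlg) : Tendsto (fun e => S.i e * x) l (𝓝 x) := by
  let D : Submodule ℂ S.ToeplitzAlg :=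
    { carrier := {x | Tendsto (fun e => S.i e * x) l (𝓝 x)}
      add_mem' := fun {x y} hx hy => by
        simpa only [Set.mem_ofPred_eq, mul_add] using! Tendsto.add hx hy
      zero_mem' := by simp [tendsto_const_nhds]
      smul_mem' := fun c x hx => by
        simpa only [Set.mem_ofPred_eq, mul_smul_comm] using! Tendsto.const_smul hx c }
  refine S.generated_i_w.mem_of_right_ideal D ?_ ?_ ?_ ?_ x
  · rw [← isSeqClosed_iff_isClosed]
    intro f y hf hy
    change Tendsto _ _ _
    rw [Metric.tendsto_nhds]
    intro ε hε
    obtain ⟨n, hn⟩ := (Metric.tendsto_atTop.mp hy (ε / 3) (by positivity))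
    have h1 := Metric.tendsto_nhds.mp (hf n) (ε / 3) (by positivity)
    have h2 := hn n le_rfl
    filter_upwards [h1, hb] with e he hbe
    rw [dist_eq_norm] at he h2 ⊢
    have h3 : ‖S.i e * (y - f n)‖ ≤ ‖f n - y‖ := by
      rw [norm_sub_rev]
      refine (norm_mul_le _ _).trans ?_
      have := (NonUnitalStarAlgHom.norm_apply_le S.i e).trans hbe.1
      nlinarith [norm_nonneg (y - f n)]
    have : S.i e * y - y = S.i e * (y - f n) + (S.i e * f n - f n) + (f n - y) := by
      rw [mul_sub]; abel
    rw [this]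
    refine (norm_add₃_le).trans_lt ?_
    linarith
  · rintro _ (⟨a, rfl⟩ | ⟨a, rfl⟩)
    · change Tendsto _ _ _
      simp only [← map_mul]
      exact (S.continuous_i.tendsto a).comp (hl a)
    · change Tendsto _ _ _
      simp only [i_mul_w]
      exact (S.continuous_w.tendsto a).comp (hl a)
  · rintro _ (⟨a, rfl⟩ | ⟨a, rfl⟩)
    · change Tendsto _ _ _
      rw [← map_star]
      simp only [← map_mul]
      exact (S.continuous_i.tendsto _).comp (hl _)
    · change Tendsto _ _ _
      suffices h : Tendsto (fun e => S.w (a * S.α e)) l (𝓝 (S.w a)) by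
        refine ((continuous_star.tendsto _).comp h).congr' ?_
        filter_upwards [hb] with e he
        rw [Function.comp_apply, ← w_mul_i, star_mul, ← map_star, he.2.1]
      rw [tendsto_iff_norm_sub_tendsto_zero]
      have key : Tendsto (fun e => Real.sqrt ‖(S.L (star a * a) - S.L (star a * a) * e) -
          e * (S.L (star a * a) - S.L (star a * a) * e)‖) l (𝓝 0) := by
        have h1 : Tendsto (fun e => S.L (star a * a) - S.L (star a * a) * e) l (𝓝 0) := by
          simpa using (hr (S.L (star a * a))).const_sub (S.L (star a * a))
        have h2 : Tendsto (fun e => e * (S.L (star a * a) - S.L (star a * a) * e)) l (𝓝 0) := by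
          refine squeeze_zero_norm' ?_ (by simpa using h1.norm)
          filter_upwards [hb] with e he
          exact (norm_mul_le _ _).trans
            (mul_le_of_le_one_left (norm_nonneg _) he.1)
        simpa using ((h1.sub h2).norm).sqrt
      refine squeeze_zero' (.of_forall fun _ => norm_nonneg _) ?_ key
      filter_upwards [hb] with e he
      have : S.w (a * S.α e) - S.w a = S.w (a * S.α e - a) := (map_sub S.wₗ _ _).symm
      rw [this]
      refine (S.norm_w_le_q _).trans ?_
      rw [S.norm_q]
      apply le_of_eq
      congr 2
      rw [star_sub, sub_mul, mul_sub, mul_sub, map_sub, map_sub, map_sub, L_mul_alpha, L_mul_alpha,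
        ← S.star_L a, L_mul_alpha, star_mul, he.2.1, S.star_L a a, mul_sub, mul_assoc]
      abel
  · intro x hx y
    change Tendsto _ _ _
    simpa only [mul_assoc] using Tendsto.mul_const y hx

lemma i_nondegenerate : IsNondegenerate S.i := by
  obtain ⟨l, hne, hb, hl, hr⟩ := exists_approxUnit A
  intro x
  refine mem_closure_of_tendsto (S.tendsto_i_mul hb hl hr x) (.of_forall fun e => ?_)
  exact Submodule.subset_span ⟨e, x, rfl⟩

lemma exists_s : ∃ m : 𝓜(ℂ, S.ToeplitzAlg), (∀ a, m.snd (S.i a) = S.w a) ∧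
    (∀ a, m.fst (S.i a) = S.w (S.α a)) ∧ ∀ a, (star m).fst (S.w a) = S.i (S.L a) := by
  obtain ⟨l, hne, hb, hl, hr⟩ := exists_approxUnit A
  have hi := S.tendsto_i_mul hb hl hr
  have hi' : ∀ x, Tendsto (fun e => x * S.i e) l (𝓝 x) := fun x => by
    refine (star_star x ▸ (continuous_star.tendsto _).comp (hi (star x))).congr' ?_
    filter_upwards [hb] with e he
    rw [Function.comp_apply, star_mul, star_star, ← map_star, he.2.1]
  have hwb : ∀ᶠ e in l, ‖S.w e‖ ≤ 1 := by
    filter_upwards [hb] with e he using (S.norm_w_le e).trans he.1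
  obtain ⟨m, hm1, hm2⟩ := exists_strict_limit (l := l) (w := S.w) hwb
    (exists_tendsto_of_dense (fun e => LinearMap.mulLeft ℂ (S.w e))
      (by
        filter_upwards [hwb] with e he x
        exact (norm_mul_le _ _).trans (mul_le_of_le_one_left (norm_nonneg _) he))
      (s := {x | ∃ b y, x = S.i b * y})
      (fun x => mem_closure_of_tendsto (hi x) (.of_forall fun e => ⟨e, x, rfl⟩))
      (by
        rintro _ ⟨b, y, rfl⟩
        refine ⟨S.w (S.α b) * y, ?_⟩
        simp only [LinearMap.mulLeft_apply, ← mul_assoc, w_mul_i]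
        exact ((S.continuous_w.tendsto _).comp (hl _)).mul_const y))
    (exists_tendsto_of_dense (fun e => LinearMap.mulRight ℂ (S.w e))
      (by
        filter_upwards [hwb] with e he x
        exact (norm_mul_le _ _).trans (mul_le_of_le_one_right (norm_nonneg _) he))
      (s := {x | ∃ b y, x = y * S.i b})
      (fun x => mem_closure_of_tendsto (hi' x) (.of_forall fun e => ⟨e, x, rfl⟩))
      (by
        rintro _ ⟨b, y, rfl⟩
        refine ⟨y * S.w b, ?_⟩
        simp only [LinearMap.mulRight_apply, mul_assoc, i_mul_w]
        exact ((S.continuous_w.tendsto _).comp (hr _)).const_mul y))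
  have e1 : ∀ a, m.snd (S.i a) = S.w a := fun a => by
    refine tendsto_nhds_unique (hm2 _) ?_
    simp only [i_mul_w]
    exact (S.continuous_w.tendsto _).comp (hr _)
  have e2 : ∀ a, m.fst (S.i a) = S.w (S.α a) := fun a => by
    refine tendsto_nhds_unique (hm1 _) ?_
    simp only [w_mul_i]
    exact (S.continuous_w.tendsto _).comp (hl _)
  refine ⟨m, e1, e2, fun a => ?_⟩
  have h : ∀ b, S.i b * (star m).fst (S.w a) = S.i b * S.i (S.L a) := fun b => by
    rw [← (star m).central, DoubleCentralizer.star_snd, ← map_star S.i, e2, star_w_mul_w, map_star S.α,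
      star_star, L_alpha_mul, map_mul]
  refine tendsto_nhds_unique (hi _) ?_
  simp only [h]
  exact hi _

/-- The canonical multiplier `s` of `T(A, α, L)`, determined by `w(a) = i(a)s`. -/
def s : 𝓜(ℂ, S.ToeplitzAlg) := S.exists_s.choose

lemma s_snd (a : A) : S.s.snd (S.i a) = S.w a := S.exists_s.choose_spec.1 a

lemma coe_w (a : A) : (S.w a : 𝓜(ℂ, S.ToeplitzAlg)) = (S.i a : 𝓜(ℂ, S.ToeplitzAlg)) * S.s := by
  rw [coe_mul, s_snd]

/-- The universal Toeplitz-covariant representation `(i, s)`. -/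
def toeplitzRep : ToeplitzRep S S.ToeplitzAlg where
  π := S.i
  nondegenerate := S.i_nondegenerate
  V := S.s
  covariant a := by
    rw [mul_coe, coe_mul, s_snd]
    exact congrArg _ (S.exists_s.choose_spec.2.1 a)
  transfer a := by
    rw [mul_assoc, coe_mul, s_snd, mul_coe]
    exact congrArg _ (S.exists_s.choose_spec.2.2 a)

lemma toeplitzRep_w (a : A) : S.toeplitzRep.w a = S.w a := S.s_snd a

/-- The graph of the homomorphism `T(A, α, L) → B` induced by a representation in `B`. -/
def liftGraph {B : Type u} [NonUnitalCStarAlgebra B] (ρ : ToeplitzRep S B) :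
    NonUnitalStarSubalgebra ℂ (S.ToeplitzAlg × B) :=
  (NonUnitalStarAlgebra.adjoin ℂ (Set.range (fun a => (S.i a, ρ.π a)) ∪
    Set.range (fun a => (S.w a, ρ.w a)))).topologicalClosure

instance {B : Type u} [NonUnitalCStarAlgebra B] (ρ : ToeplitzRep S B) :
    IsClosed (S.liftGraph ρ : Set (S.ToeplitzAlg × B)) :=
  NonUnitalStarSubalgebra.isClosed_topologicalClosure _

lemma eval_toBig (x : Poly A) (p : S.RepIndex) :
    S.toBig (x.eval S.i S.w) p = x.eval (S.rep p).π (S.rep p).w := by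
  induction x with
  | i a => rfl
  | w a => rfl
  | add x y hx hy => simp only [Poly.eval, map_add, ← hx, ← hy]; rfl
  | mul x y hx hy => simp only [Poly.eval, map_mul, ← hx, ← hy]; rfl
  | smul c x hx => simp only [Poly.eval, map_smul, ← hx]; rfl
  | star x hx => simp only [Poly.eval, map_star, ← hx]; rfl

lemma norm_snd_le_of_mem_liftGraph {B : Type u} [NonUnitalCStarAlgebra B] (ρ : ToeplitzRep S B)
    (z : S.ToeplitzAlg × B) (hz : z ∈ S.liftGraph ρ) : ‖z.2‖ ≤ ‖z.1‖ := by
  have hc : IsClosed {z : S.ToeplitzAlg × B | ‖z.2‖ ≤ ‖z.1‖} :=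
    isClosed_le (by fun_prop) (by fun_prop)
  refine closure_minimal ?_ hc hz
  intro z hz
  have : ∃ x : Poly A, z = (x.eval S.i S.w, x.eval ρ.π ρ.w) := by
    refine NonUnitalStarAlgebra.adjoin_induction (R := ℂ)
      (p := fun z _ => ∃ x : Poly A, z = (x.eval S.i S.w, x.eval ρ.π ρ.w))
      ?_ ?_ ?_ ?_ ?_ ?_ hz
    · rintro _ (⟨a, rfl⟩ | ⟨a, rfl⟩)
      · exact ⟨.i a, rfl⟩
      · exact ⟨.w a, rfl⟩
    · rintro _ _ _ _ ⟨x, rfl⟩ ⟨y, rfl⟩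
      exact ⟨.add x y, rfl⟩
    · exact ⟨.i 0, by simp only [Poly.eval, map_zero]; rfl⟩
    · rintro _ _ _ _ ⟨x, rfl⟩ ⟨y, rfl⟩
      exact ⟨.mul x y, rfl⟩
    · rintro c _ _ ⟨x, rfl⟩
      exact ⟨.smul c x, rfl⟩
    · rintro _ _ ⟨x, rfl⟩
      exact ⟨.star x, rfl⟩
  obtain ⟨x, rfl⟩ := this
  let p : S.RepIndex := ⟨fun x => ‖x.eval ρ.π ρ.w‖, B, inferInstance, ρ, fun _ => rfl⟩
  have h1 : ‖x.eval ρ.π ρ.w‖ = ‖S.toBig (x.eval S.i S.w) p‖ := by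
    rw [eval_toBig, ← S.rep_spec p x]
  change ‖x.eval ρ.π ρ.w‖ ≤ ‖x.eval S.i S.w‖
  rw [h1, ← norm_toBig]
  exact lp.norm_apply_le_norm ENNReal.top_ne_zero _ _

/-- The projection of the graph. -/
def liftFst {B : Type u} [NonUnitalCStarAlgebra B] (ρ : ToeplitzRep S B) :
    S.liftGraph ρ →⋆ₙₐ[ℂ] S.ToeplitzAlg :=
  (NonUnitalStarAlgHom.fst ℂ S.ToeplitzAlg B).comp
    (NonUnitalStarSubalgebraClass.subtype (S.liftGraph ρ))

lemma liftFst_bijective {B : Type u} [NonUnitalCStarAlgebra B] (ρ : ToeplitzRep S B) :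
    Function.Bijective (S.liftFst ρ) := by
  have hiso : Isometry (S.liftFst ρ) := by
    refine AddMonoidHomClass.isometry_of_norm _ fun z => ?_
    exact (max_eq_left (S.norm_snd_le_of_mem_liftGraph ρ z.1 z.2)).symm
  refine ⟨hiso.injective, fun x => ?_⟩
  have hcl : IsClosed (NonUnitalStarAlgHom.range (S.liftFst ρ) : Set S.ToeplitzAlg) := by
    have := hiso.isClosedEmbedding.isClosed_range
    rwa [NonUnitalStarAlgHom.coe_range]
  have hle : (NonUnitalStarAlgebra.adjoin ℂ
      (Set.range S.i ∪ Set.range S.w)).topologicalClosure ≤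
      NonUnitalStarAlgHom.range (S.liftFst ρ) := by
    refine NonUnitalStarSubalgebra.topologicalClosure_minimal _ ?_ hcl
    refine NonUnitalStarAlgebra.adjoin_le ?_
    rintro _ (⟨a, rfl⟩ | ⟨a, rfl⟩)
    · exact ⟨⟨(S.i a, ρ.π a), NonUnitalStarSubalgebra.le_topologicalClosure _
        (NonUnitalStarAlgebra.subset_adjoin ℂ _ (.inl ⟨a, rfl⟩))⟩, rfl⟩
    · exact ⟨⟨(S.w a, ρ.w a), NonUnitalStarSubalgebra.le_topologicalClosure _
        (NonUnitalStarAlgebra.subset_adjoin ℂ _ (.inr ⟨a, rfl⟩))⟩, rfl⟩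
  rw [S.generated_i_w] at hle
  exact hle (x := x) trivial

/-- The homomorphism `T(A, α, L) → B` induced by a Toeplitz-covariant representation in `B`. -/
def lift {B : Type u} [NonUnitalCStarAlgebra B] (ρ : ToeplitzRep S B) :
    S.ToeplitzAlg →⋆ₙₐ[ℂ] B :=
  ((NonUnitalStarAlgHom.snd ℂ S.ToeplitzAlg B).comp
    (NonUnitalStarSubalgebraClass.subtype (S.liftGraph ρ))).comp
    ((StarAlgEquiv.ofBijective (S.liftFst ρ) (S.liftFst_bijective ρ)).symm :
      S.ToeplitzAlg →⋆ₙₐ[ℂ] S.liftGraph ρ)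

lemma lift_eq_of_mem {B : Type u} [NonUnitalCStarAlgebra B] (ρ : ToeplitzRep S B)
    {x : S.ToeplitzAlg} {y : B} (h : (x, y) ∈ S.liftGraph ρ) : S.lift ρ x = y := by
  have : (StarAlgEquiv.ofBijective (S.liftFst ρ) (S.liftFst_bijective ρ)).symm x = ⟨(x, y), h⟩ := by
    rw [StarAlgEquiv.symm_apply_eq]
    rfl
  change ((StarAlgEquiv.ofBijective (S.liftFst ρ) (S.liftFst_bijective ρ)).symm x).1.2 = y
  rw [this]

lemma lift_i {B : Type u} [NonUnitalCStarAlgebra B] (ρ : ToeplitzRep S B) (a : A) :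
    S.lift ρ (S.i a) = ρ.π a :=
  S.lift_eq_of_mem ρ (NonUnitalStarSubalgebra.le_topologicalClosure _
    (NonUnitalStarAlgebra.subset_adjoin ℂ _ (.inl ⟨a, rfl⟩)))

lemma lift_w {B : Type u} [NonUnitalCStarAlgebra B] (ρ : ToeplitzRep S B) (a : A) :
    S.lift ρ (S.w a) = ρ.w a :=
  S.lift_eq_of_mem ρ (NonUnitalStarSubalgebra.le_topologicalClosure _
    (NonUnitalStarAlgebra.subset_adjoin ℂ _ (.inr ⟨a, rfl⟩)))

lemma hom_ext {B : Type*} [NonUnitalCStarAlgebra B] {f g : S.ToeplitzAlg →⋆ₙₐ[ℂ] B}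
    (hi : ∀ a, f (S.i a) = g (S.i a)) (hw : ∀ a, f (S.w a) = g (S.w a)) : f = g := by
  have hf : ∀ f : S.ToeplitzAlg →⋆ₙₐ[ℂ] B, Continuous f := fun f =>
    AddMonoidHomClass.continuous_of_bound f 1 fun a => by
      rw [one_mul]; exact NonUnitalStarAlgHom.norm_apply_le _ _
  have hcl : IsClosed (NonUnitalStarAlgHom.equalizer f g : Set S.ToeplitzAlg) :=
    isClosed_eq (hf f) (hf g)
  have hle : (NonUnitalStarAlgebra.adjoin ℂ
      (Set.range S.i ∪ Set.range S.w)).topologicalClosure ≤ NonUnitalStarAlgHom.equalizer f g := by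
    refine NonUnitalStarSubalgebra.topologicalClosure_minimal _ ?_ hcl
    refine NonUnitalStarAlgebra.adjoin_le ?_
    rintro _ (⟨a, rfl⟩ | ⟨a, rfl⟩)
    · exact hi a
    · exact hw a
  rw [S.generated_i_w] at hle
  ext x
  exact hle (x := x) trivial

/-- The universal property of `(T(A, α, L), i, s)`: every Toeplitz-covariant representation
`(π, V)` in a C⋆-algebra `B` is `(Φ ∘ i, Φ(s))` for a unique homomorphism `Φ`, which is
nondegenerate; the second condition is stated as `Φ(s x) = V Φ(x)`. -/
theorem toeplitz_universal {B : Type u} [NonUnitalCStarAlgebra B] (ρ : ToeplitzRep S B) :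
    ∃! Φ : S.ToeplitzAlg →⋆ₙₐ[ℂ] B, IsNondegenerate Φ ∧ (∀ a, Φ (S.i a) = ρ.π a) ∧
      ∀ x, Φ (S.s.fst x) = ρ.V.fst (Φ x) := by
  have key : ∀ Φ : S.ToeplitzAlg →⋆ₙₐ[ℂ] B, (∀ a, Φ (S.i a) = ρ.π a) →
      (∀ a, Φ (S.w a) = ρ.w a) → ∀ x, Φ (S.s.fst x) = ρ.V.fst (Φ x) := by
    intro Φ h1 h2 x
    have hΦ : Continuous Φ := AddMonoidHomClass.continuous_of_bound Φ 1 fun a => by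
      rw [one_mul]; exact NonUnitalStarAlgHom.norm_apply_le _ _
    obtain ⟨l, hne, hb, hl, hr⟩ := exists_approxUnit A
    have hi := S.tendsto_i_mul hb hl hr x
    refine tendsto_nhds_unique
      ((hΦ.comp S.s.fst.continuous).tendsto _ |>.comp hi)
      (((ρ.V.fst.continuous.comp hΦ).tendsto _ |>.comp hi).congr fun e => ?_)
    simp only [Function.comp_apply, map_mul, fst_mul, h1]
    have h3 : S.s.fst (S.i e) = S.w (S.α e) := S.exists_s.choose_spec.2.1 e
    rw [h3, h2]
    congr 1
    apply coe_injective
    simp only [← mul_coe, ρ.covariant, ρ.coe_w]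
  have hw : ∀ Φ : S.ToeplitzAlg →⋆ₙₐ[ℂ] B, IsNondegenerate Φ → (∀ a, Φ (S.i a) = ρ.π a) →
      (∀ x, Φ (S.s.fst x) = ρ.V.fst (Φ x)) → ∀ a, Φ (S.w a) = ρ.w a := by
    intro Φ hn h1 h2 a
    have h3 : ∀ x, Φ (S.w a) * Φ x = ρ.w a * Φ x := fun x => by
      rw [← map_mul, ← s_snd, S.s.central, map_mul, h1, h2, ToeplitzRep.w, ρ.V.central]
    have h4 : ∀ y, Φ (S.w a) * y = ρ.w a * y := by
      intro y
      have hcl : IsClosed ((LinearMap.eqLocus (LinearMap.mulLeft ℂ (Φ (S.w a)))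
          (LinearMap.mulLeft ℂ (ρ.w a)) : Submodule ℂ B) : Set B) :=
        isClosed_eq (continuous_const.mul continuous_id) (continuous_const.mul continuous_id)
      refine closure_minimal (Submodule.span_le.mpr ?_) hcl (hn y)
      rintro _ ⟨x, b, rfl⟩
      change Φ (S.w a) * (Φ x * b) = ρ.w a * (Φ x * b)
      rw [← mul_assoc, h3, mul_assoc]
    rw [← sub_eq_zero, ← CStarRing.mul_star_self_eq_zero_iff, sub_mul, h4, sub_self]
  refine ⟨S.lift ρ, ⟨?_, S.lift_i ρ, key _ (S.lift_i ρ) (S.lift_w ρ)⟩, ?_⟩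
  · refine ρ.nondegenerate.mono (Submodule.span_mono ?_)
    rintro _ ⟨a, b, rfl⟩
    exact ⟨S.i a, b, by rw [lift_i]⟩
  · rintro Φ ⟨hn, h1, h2⟩
    exact S.hom_ext (fun a => by rw [h1, lift_i]) fun a => by rw [hw Φ hn h1 h2, lift_w]

end ExelSystem
end Toeplitz

section Quotients

variable {T : Type*} [NonUnitalCStarAlgebra T]

/-- Closed two-sided (hence self-adjoint) ideals of a C⋆-algebra. -/
structure ClosedIdeal (T : Type*) [NonUnitalCStarAlgebra T] extends Submodule ℂ T where
  mul_mem_left' : ∀ x y, y ∈ carrier → x * y ∈ carrier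
  mul_mem_right' : ∀ x y, x ∈ carrier → x * y ∈ carrier
  star_mem' : ∀ x, x ∈ carrier → star x ∈ carrier
  isClosed' : IsClosed carrier

namespace ClosedIdeal

/-- The closed ideal generated by a set: the intersection of all closed ideals containing it. -/
def generatedBy (X : Set T) : ClosedIdeal T where
  carrier := {x | ∀ I : ClosedIdeal T, X ⊆ I.carrier → x ∈ I.carrier}
  add_mem' hx hy I hI := I.add_mem (hx I hI) (hy I hI)
  zero_mem' I _ := I.zero_mem
  smul_mem' c _ hx I hI := I.smul_mem c (hx I hI)
  mul_mem_left' x y hy I hI := I.mul_mem_left' x y (hy I hI)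
  mul_mem_right' x y hx I hI := I.mul_mem_right' x y (hx I hI)
  star_mem' x hx I hI := I.star_mem' x (hx I hI)
  isClosed' := by
    simp only [Set.ofPred_forall]
    exact isClosed_iInter fun I => isClosed_iInter fun _ => I.isClosed'

lemma subset_generatedBy (X : Set T) : X ⊆ (generatedBy X).carrier := fun _ hx _ hI => hI hx

variable (I : ClosedIdeal T)

/-- A closed ideal as a C⋆-subalgebra. -/
def toSubalgebra : NonUnitalStarSubalgebra ℂ T where
  carrier := I.carrier
  add_mem' := I.add_mem'
  zero_mem' := I.zero_mem'
  smul_mem' := I.smul_mem'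
  mul_mem' := fun {x y} hx _ => I.mul_mem_right' x y hx
  star_mem' := fun {x} hx => I.star_mem' x hx

instance : IsClosed (I.toSubalgebra : Set T) := I.isClosed'

instance : IsClosed (I.toSubmodule : Set T) := I.isClosed'

/-- For `y` in the ideal there is `e` in the ideal with `y e` close to `y` and `‖1 - e‖ ≤ 1`. -/
lemma exists_approx {y : T} (hy : y ∈ I.carrier) {ε : ℝ} (hε : 0 < ε) :
    ∃ e ∈ I.carrier, star e = e ∧ (∀ z : T, ‖z - z * e‖ ≤ ‖z‖) ∧ ‖y - y * e‖ < ε := by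
  let _ := CStarAlgebra.spectralOrder I.toSubalgebra
  let _ := CStarAlgebra.spectralOrderedRing I.toSubalgebra
  let _ := CStarAlgebra.spectralOrder T
  let _ := CStarAlgebra.spectralOrderedRing T
  have h := CStarAlgebra.increasingApproximateUnit I.toSubalgebra
  have := h.neBot
  have h1 := Metric.tendsto_nhds.mp (h.tendsto_mul_left ⟨y, hy⟩) ε hε
  obtain ⟨e, h1, h2, h3, h4⟩ := (h1.and (h.eventually_norm.and
    (h.eventually_nonneg.and h.eventually_star_eq))).exists
  refine ⟨e.1, e.2, congrArg Subtype.val h4, fun z => ?_, ?_⟩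
  · have hpos : (0 : T) ≤ e.1 := by
      obtain ⟨b, hb⟩ := CStarAlgebra.nonneg_iff_eq_star_mul_self.mp h3
      rw [hb]
      exact star_mul_self_nonneg b.1
    have := CStarAlgebra.norm_sub_mul_self_le_of_inr (x := 0) (y := e.1) (star z) le_rfl hpos h2
      (norm_nonneg z) (by
        rw [Unitization.inr_zero, sub_zero, mul_one, CStarRing.norm_star_mul_self,
          Unitization.norm_inr, norm_star, sq])
    rw [← norm_star]
    have h5 : star e.1 = e.1 := congrArg Subtype.val h4
    simpa [h5] using this
  · rw [dist_eq_norm, norm_sub_rev] at h1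
    exact h1

/-- The quotient of a C⋆-algebra by a closed ideal, with the quotient norm. -/
def Quotient : Type _ := T ⧸ I.toSubmodule

instance : NormedAddCommGroup I.Quotient := inferInstanceAs (NormedAddCommGroup (T ⧸ I.toSubmodule))

instance : NormedSpace ℂ I.Quotient := inferInstanceAs (NormedSpace ℂ (T ⧸ I.toSubmodule))

instance : CompleteSpace I.Quotient := inferInstanceAs (CompleteSpace (T ⧸ I.toSubmodule))

/-- The quotient map as a linear map. -/
def mkₗ : T →L[ℂ] I.Quotient := I.toSubmodule.mkQL

lemma mkₗ_surjective : Function.Surjective I.mkₗ := I.toSubmodule.mkQ_surjective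

lemma mkₗ_eq_iff {x y : T} : I.mkₗ x = I.mkₗ y ↔ x - y ∈ I.carrier :=
  Submodule.Quotient.eq I.toSubmodule

lemma norm_mkₗ_le (x : T) : ‖I.mkₗ x‖ ≤ ‖x‖ := Submodule.Quotient.norm_mk_le I.toSubmodule x

lemma exists_norm_lt (x : I.Quotient) {ε : ℝ} (hε : 0 < ε) :
    ∃ m : T, I.mkₗ m = x ∧ ‖m‖ < ‖x‖ + ε :=
  Submodule.Quotient.norm_mk_lt (S := I.toSubmodule) x hε

instance : Mul I.Quotient where
  mul := Quotient.map₂ (· * ·) (by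
    intro a b hab c d hcd
    rw [← Quotient.eq_iff_equiv] at hab hcd ⊢
    have h1 : a - b ∈ I.carrier := (Submodule.Quotient.eq I.toSubmodule).mp hab
    have h2 : c - d ∈ I.carrier := (Submodule.Quotient.eq I.toSubmodule).mp hcd
    refine (Submodule.Quotient.eq I.toSubmodule).mpr ?_
    have : a * c - b * d = (a - b) * c + b * (c - d) := by rw [sub_mul, mul_sub]; abel
    rw [this]
    exact I.add_mem (I.mul_mem_right' _ _ h1) (I.mul_mem_left' _ _ h2))

instance : Star I.Quotient where
  star := Quotient.map star (by
    intro a b hab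
    rw [← Quotient.eq_iff_equiv] at hab ⊢
    have h1 : a - b ∈ I.carrier := (Submodule.Quotient.eq I.toSubmodule).mp hab
    refine (Submodule.Quotient.eq I.toSubmodule).mpr ?_
    rw [← star_sub]
    exact I.star_mem' _ h1)

lemma mkₗ_mul (x y : T) : I.mkₗ (x * y) = I.mkₗ x * I.mkₗ y := rfl

lemma mkₗ_star (x : T) : I.mkₗ (star x) = star (I.mkₗ x) := rfl

instance : NonUnitalNormedRing I.Quotient where
  left_distrib := by
    rintro a b c
    obtain ⟨a, rfl⟩ := I.mkₗ_surjective a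
    obtain ⟨b, rfl⟩ := I.mkₗ_surjective b
    obtain ⟨c, rfl⟩ := I.mkₗ_surjective c
    simp only [← map_add, ← mkₗ_mul, mul_add]
  right_distrib := by
    rintro a b c
    obtain ⟨a, rfl⟩ := I.mkₗ_surjective a
    obtain ⟨b, rfl⟩ := I.mkₗ_surjective b
    obtain ⟨c, rfl⟩ := I.mkₗ_surjective c
    simp only [← map_add, ← mkₗ_mul, add_mul]
  zero_mul := by
    rintro a
    obtain ⟨a, rfl⟩ := I.mkₗ_surjective a
    rw [← map_zero I.mkₗ, ← mkₗ_mul, zero_mul]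
  mul_zero := by
    rintro a
    obtain ⟨a, rfl⟩ := I.mkₗ_surjective a
    rw [← map_zero I.mkₗ, ← mkₗ_mul, mul_zero]
  mul_assoc := by
    rintro a b c
    obtain ⟨a, rfl⟩ := I.mkₗ_surjective a
    obtain ⟨b, rfl⟩ := I.mkₗ_surjective b
    obtain ⟨c, rfl⟩ := I.mkₗ_surjective c
    simp only [← mkₗ_mul, mul_assoc]
  dist_eq := NormedAddCommGroup.dist_eq
  norm_mul_le a b := by
    have h : ∀ ε > 0, ‖a * b‖ ≤ (‖a‖ + ε) * (‖b‖ + ε) := fun ε hε => by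
      obtain ⟨x, rfl, hx⟩ := I.exists_norm_lt a hε
      obtain ⟨y, rfl, hy⟩ := I.exists_norm_lt b hε
      rw [← mkₗ_mul]
      refine (I.norm_mkₗ_le _).trans ((norm_mul_le _ _).trans ?_)
      gcongr
    have hlim : Tendsto (fun ε : ℝ => (‖a‖ + ε) * (‖b‖ + ε)) (𝓝[>] 0) (𝓝 (‖a‖ * ‖b‖)) := by
      have : Continuous (fun ε : ℝ => (‖a‖ + ε) * (‖b‖ + ε)) := by fun_prop
      simpa using (this.tendsto 0).mono_left nhdsWithin_le_nhds
    exact ge_of_tendsto hlim (Filter.eventually_of_mem self_mem_nhdsWithin h)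

instance : StarRing I.Quotient where
  star_involutive := by
    rintro a
    obtain ⟨a, rfl⟩ := I.mkₗ_surjective a
    simp only [← mkₗ_star, star_star]
  star_mul := by
    rintro a b
    obtain ⟨a, rfl⟩ := I.mkₗ_surjective a
    obtain ⟨b, rfl⟩ := I.mkₗ_surjective b
    simp only [← mkₗ_mul, ← mkₗ_star, star_mul]
  star_add := by
    rintro a b
    obtain ⟨a, rfl⟩ := I.mkₗ_surjective a
    obtain ⟨b, rfl⟩ := I.mkₗ_surjective b
    simp only [← map_add, ← mkₗ_star, star_add]

lemma quotient_norm_mul_self_le (x : I.Quotient) : ‖x‖ * ‖x‖ ≤ ‖star x * x‖ := by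
  obtain ⟨x, rfl⟩ := I.mkₗ_surjective x
  refine le_of_forall_pos_le_add fun ε hε => ?_
  rw [← mkₗ_star, ← mkₗ_mul]
  obtain ⟨m, hm, hn⟩ := I.exists_norm_lt (I.mkₗ (star x * x)) (half_pos hε)
  have hy : star x * x - m ∈ I.carrier := I.mkₗ_eq_iff.mp hm.symm
  obtain ⟨e, he, hs, hz, hye⟩ := I.exists_approx hy (half_pos hε)
  have h1 : ‖I.mkₗ x‖ ≤ ‖x - x * e‖ := by
    have : I.mkₗ x = I.mkₗ (x - x * e) := by
      rw [mkₗ_eq_iff, sub_sub_cancel]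
      exact I.mul_mem_left' _ _ he
    rw [this]
    exact I.norm_mkₗ_le _
  have hz' : ∀ z : T, ‖z - e * z‖ ≤ ‖z‖ := fun z => by
    have := hz (star z)
    rw [← norm_star, star_sub, star_mul, star_star, hs, norm_star] at this
    exact this
  have h2 : ‖x - x * e‖ * ‖x - x * e‖ ≤ ‖m‖ + ‖(star x * x - m) - (star x * x - m) * e‖ := by
    rw [← CStarRing.norm_star_mul_self]
    have e1 : star (x - x * e) * (x - x * e) =
        ((m - m * e) - e * (m - m * e)) + (((star x * x - m) - (star x * x - m) * e) -
          e * ((star x * x - m) - (star x * x - m) * e)) := by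
      simp only [star_sub, star_mul, hs, sub_mul, mul_sub, mul_assoc]
      abel
    rw [e1]
    exact (norm_add_le _ _).trans (add_le_add ((hz' _).trans (hz _)) (hz' _))
  calc _ ≤ ‖x - x * e‖ * ‖x - x * e‖ := by gcongr
    _ ≤ _ := by linarith

instance : NonUnitalCStarAlgebra I.Quotient where
  norm_mul_self_le := I.quotient_norm_mul_self_le
  smul_assoc c a b := by
    obtain ⟨a, rfl⟩ := I.mkₗ_surjective a
    obtain ⟨b, rfl⟩ := I.mkₗ_surjective b
    simp only [smul_eq_mul, ← map_smul, ← mkₗ_mul, smul_mul_assoc]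
  smul_comm c a b := by
    obtain ⟨a, rfl⟩ := I.mkₗ_surjective a
    obtain ⟨b, rfl⟩ := I.mkₗ_surjective b
    simp only [smul_eq_mul, ← map_smul, ← mkₗ_mul, mul_smul_comm]
  star_smul c a := by
    obtain ⟨a, rfl⟩ := I.mkₗ_surjective a
    simp only [← map_smul, ← mkₗ_star, star_smul]

/-- The quotient homomorphism. -/
def quot : T →⋆ₙₐ[ℂ] I.Quotient where
  toFun := I.mkₗ
  map_smul' := map_smul I.mkₗ
  map_zero' := map_zero I.mkₗ
  map_add' := map_add I.mkₗ
  map_mul' := I.mkₗ_mul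
  map_star' := I.mkₗ_star

lemma quot_surjective : Function.Surjective I.quot := I.mkₗ_surjective

lemma quot_eq_zero_iff (x : T) : I.quot x = 0 ↔ x ∈ I.carrier :=
  Submodule.Quotient.mk_eq_zero I.toSubmodule

/-- The homomorphism on the quotient induced by a homomorphism vanishing on the ideal. -/
def lift {B : Type*} [NonUnitalCStarAlgebra B] (f : T →⋆ₙₐ[ℂ] B)
    (hf : ∀ x ∈ I.carrier, f x = 0) : I.Quotient →⋆ₙₐ[ℂ] B :=
  let g : I.Quotient →ₗ[ℂ] B := I.toSubmodule.liftQ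
    { toFun := f, map_add' := map_add f, map_smul' := map_smul f } hf
  { toFun := g
    map_smul' := map_smul g
    map_zero' := map_zero g
    map_add' := map_add g
    map_mul' := fun a b => by
      obtain ⟨a, rfl⟩ := I.mkₗ_surjective a
      obtain ⟨b, rfl⟩ := I.mkₗ_surjective b
      exact map_mul f a b
    map_star' := fun a => by
      obtain ⟨a, rfl⟩ := I.mkₗ_surjective a
      exact map_star f a }

lemma lift_quot {B : Type*} [NonUnitalCStarAlgebra B] (f : T →⋆ₙₐ[ℂ] B)
    (hf : ∀ x ∈ I.carrier, f x = 0) (x : T) : I.lift f hf (I.quot x) = f x := rfl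

lemma fst_mem (m : 𝓜(ℂ, T)) {x : T} (hx : x ∈ I.carrier) : m.fst x ∈ I.carrier := by
  obtain ⟨l, hne, -, hl, -⟩ := exists_approxUnit T
  refine I.isClosed'.mem_of_tendsto ((m.fst.continuous.tendsto _).comp (hl x))
    (.of_forall fun e => ?_)
  rw [Function.comp_apply, fst_mul]
  exact I.mul_mem_left' _ _ hx

lemma snd_mem (m : 𝓜(ℂ, T)) {x : T} (hx : x ∈ I.carrier) : m.snd x ∈ I.carrier := by
  obtain ⟨l, hne, -, -, hr⟩ := exists_approxUnit T
  refine I.isClosed'.mem_of_tendsto ((m.snd.continuous.tendsto _).comp (hr x))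
    (.of_forall fun e => ?_)
  rw [Function.comp_apply, snd_mul]
  exact I.mul_mem_right' _ _ hx

/-- The extension `M(T) → M(T/I)` of the quotient map: the image of `m` is the multiplier with
`m (x + I) = m x + I` and `(x + I) m = x m + I`. -/
def quotBar (m : 𝓜(ℂ, T)) : 𝓜(ℂ, I.Quotient) where
  fst := I.toSubmodule.liftQL (I.mkₗ.comp m.fst) fun x hx =>
    (I.quot_eq_zero_iff _).mpr (I.fst_mem m hx)
  snd := I.toSubmodule.liftQL (I.mkₗ.comp m.snd) fun x hx =>
    (I.quot_eq_zero_iff _).mpr (I.snd_mem m hx)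
  central a b := by
    obtain ⟨a, rfl⟩ := I.mkₗ_surjective a
    obtain ⟨b, rfl⟩ := I.mkₗ_surjective b
    exact congrArg I.mkₗ (m.central a b)

lemma quotBar_fst (m : 𝓜(ℂ, T)) (x : T) : (I.quotBar m).fst (I.quot x) = I.quot (m.fst x) := rfl

lemma quotBar_snd (m : 𝓜(ℂ, T)) (x : T) : (I.quotBar m).snd (I.quot x) = I.quot (m.snd x) := rfl

end ClosedIdeal

end Quotients

namespace ExelSystem

variable {A : Type u} [NonUnitalCStarAlgebra A] (S : ExelSystem A)

/-! ### The Exel crossed product -/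

/-- The linear map `ψ_s : M_L → T(A, α, L)` with `ψ_s(q(a)) = i(a)s`. -/
def ψ : S.ML →L[ℂ] S.ToeplitzAlg := S.wₗ.extendOfNorm S.q

lemma ψ_q (a : A) : S.ψ (S.q a) = S.w a :=
  LinearMap.extendOfNorm_eq S.denseRange_q
    ⟨1, fun a => by rw [one_mul]; exact S.norm_w_le_q a⟩ a

/-- The graph of the homomorphism `(ψ_s, i)^(1) : K(M_L) → T(A, α, L)` determined by
`(ψ_s, i)^(1)(Θ_{m,n}) = ψ_s(m) ψ_s(n)*`: since that homomorphism is continuous and `K(M_L)` is the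
closed span of the `Θ_{m,n}`, its graph is the closed span of the pairs
`(Θ_{m,n}, ψ_s(m) ψ_s(n)*)`. -/
def compactGraph : Submodule ℂ ((S.ML →L[ℂ] S.ML) × S.ToeplitzAlg) :=
  (Submodule.span ℂ {z | ∃ m n, z = (S.rankOne m n, S.ψ m * star (S.ψ n))}).topologicalClosure

/-- The elements `i(a) - (ψ_s, i)^(1)(φ(a))` of `T(A, α, L)`, for `a` in `K_α`. -/
def exelRelations : Set S.ToeplitzAlg :=
  {x | ∃ a ∈ S.Kα, ∃ y, (S.leftAction a, y) ∈ S.compactGraph ∧ x = S.i a - y}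

/-- The closed ideal of `T(A, α, L)` generated by these elements. -/
def exelIdeal : ClosedIdeal S.ToeplitzAlg := ClosedIdeal.generatedBy S.exelRelations

/-- The Exel crossed product `A ⋊_{α,L} ℕ`. -/
def ExelProduct : Type u := S.exelIdeal.Quotient

instance : NonUnitalCStarAlgebra S.ExelProduct :=
  inferInstanceAs (NonUnitalCStarAlgebra S.exelIdeal.Quotient)

/-- The quotient map `T(A, α, L) → A ⋊_{α,L} ℕ`. -/
def Q : S.ToeplitzAlg →⋆ₙₐ[ℂ] S.ExelProduct := S.exelIdeal.quot

/-- The canonical homomorphism `j : A → A ⋊_{α,L} ℕ`. -/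
def j : A →⋆ₙₐ[ℂ] S.ExelProduct := S.Q.comp S.i

/-- The canonical multiplier `t` of `A ⋊_{α,L} ℕ`, the image of `s`. -/
def t : 𝓜(ℂ, S.ExelProduct) := S.exelIdeal.quotBar S.s

/-! ### The dual action and its fixed-point algebra -/

/-- The Toeplitz-covariant representation `(i, zs)`. -/
def rotatedRep (z : Circle) : ToeplitzRep S S.ToeplitzAlg where
  π := S.i
  nondegenerate := S.i_nondegenerate
  V := (z : ℂ) • S.s
  covariant a := by
    rw [smul_mul_assoc, mul_smul_comm]
    exact congrArg _ (S.toeplitzRep.covariant a)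
  transfer a := by
    rw [star_smul, smul_mul_assoc, smul_mul_assoc, mul_smul_comm, smul_smul]
    have hz : star (z : ℂ) * (z : ℂ) = 1 := by
      rw [Complex.star_def, ← Complex.normSq_eq_conj_mul_self, Circle.normSq_coe, Complex.ofReal_one]
    rw [hz, one_smul]
    exact S.toeplitzRep.transfer a

/-- The dual action on `T(A, α, L)`. -/
def toeplitzGauge (z : Circle) : S.ToeplitzAlg →⋆ₙₐ[ℂ] S.ToeplitzAlg := S.lift (S.rotatedRep z)

lemma toeplitzGauge_i (z : Circle) (a : A) : S.toeplitzGauge z (S.i a) = S.i a := S.lift_i _ a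

lemma toeplitzGauge_w (z : Circle) (a : A) : S.toeplitzGauge z (S.w a) = (z : ℂ) • S.w a := by
  rw [toeplitzGauge, lift_w, ← s_snd]
  rfl

lemma continuous_toeplitzGauge (z : Circle) : Continuous (S.toeplitzGauge z) :=
  AddMonoidHomClass.continuous_of_bound (S.toeplitzGauge z) 1 fun a => by
    rw [one_mul]; exact NonUnitalStarAlgHom.norm_apply_le _ _

lemma toeplitzGauge_ψ (z : Circle) (m : S.ML) :
    S.toeplitzGauge z (S.ψ m) = (z : ℂ) • S.ψ m := by
  refine congrFun (S.denseRange_q.equalizer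
    ((S.continuous_toeplitzGauge z).comp S.ψ.continuous)
    (S.ψ.continuous.const_smul (z : ℂ)) (funext fun a => ?_)) m
  simp only [Function.comp_apply, Pi.smul_apply, ψ_q, toeplitzGauge_w]

lemma toeplitzGauge_compactGraph (z : Circle) (p : (S.ML →L[ℂ] S.ML) × S.ToeplitzAlg)
    (hp : p ∈ S.compactGraph) : S.toeplitzGauge z p.2 = p.2 := by
  let D : Submodule ℂ ((S.ML →L[ℂ] S.ML) × S.ToeplitzAlg) :=
    { carrier := {p | S.toeplitzGauge z p.2 = p.2}
      add_mem' := fun {p q} (hp : _ = _) (hq : _ = _) => by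
        change S.toeplitzGauge z (p.2 + q.2) = p.2 + q.2
        rw [map_add, hp, hq]
      zero_mem' := map_zero (S.toeplitzGauge z)
      smul_mem' := fun c p (hp : _ = _) => by
        change S.toeplitzGauge z (c • p.2) = c • p.2
        rw [map_smul, hp] }
  have hD : IsClosed (D : Set ((S.ML →L[ℂ] S.ML) × S.ToeplitzAlg)) :=
    isClosed_eq ((S.continuous_toeplitzGauge z).comp continuous_snd) continuous_snd
  refine closure_minimal (Submodule.span_le.mpr ?_) hD hp
  rintro _ ⟨m, n, rfl⟩
  change S.toeplitzGauge z (S.ψ m * star (S.ψ n)) = S.ψ m * star (S.ψ n)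
  have hz : star (z : ℂ) * (z : ℂ) = 1 := by
    rw [Complex.star_def, ← Complex.normSq_eq_conj_mul_self, Circle.normSq_coe, Complex.ofReal_one]
  rw [map_mul, map_star, toeplitzGauge_ψ, toeplitzGauge_ψ, star_smul, smul_mul_assoc,
    mul_smul_comm, smul_smul, mul_comm, hz, one_smul]

lemma toeplitzGauge_mem (z : Circle) (x : S.ToeplitzAlg) (hx : x ∈ S.exelIdeal.carrier) :
    S.toeplitzGauge z x ∈ S.exelIdeal.carrier := by
  let J : ClosedIdeal S.ToeplitzAlg :=
    { carrier := {x | S.toeplitzGauge z x ∈ S.exelIdeal.carrier}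
      add_mem' := fun {x y} hx hy => by
        change S.toeplitzGauge z (x + y) ∈ S.exelIdeal.carrier
        rw [map_add]; exact S.exelIdeal.add_mem hx hy
      zero_mem' := by
        change S.toeplitzGauge z 0 ∈ S.exelIdeal.carrier
        rw [map_zero]; exact S.exelIdeal.zero_mem
      smul_mem' := fun c x hx => by
        change S.toeplitzGauge z (c • x) ∈ S.exelIdeal.carrier
        rw [map_smul]; exact S.exelIdeal.smul_mem c hx
      mul_mem_left' := fun x y hy => by
        change S.toeplitzGauge z (x * y) ∈ S.exelIdeal.carrier
        rw [map_mul]; exact S.exelIdeal.mul_mem_left' _ _ hy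
      mul_mem_right' := fun x y hx => by
        change S.toeplitzGauge z (x * y) ∈ S.exelIdeal.carrier
        rw [map_mul]; exact S.exelIdeal.mul_mem_right' _ _ hx
      star_mem' := fun x hx => by
        change S.toeplitzGauge z (star x) ∈ S.exelIdeal.carrier
        rw [map_star]; exact S.exelIdeal.star_mem' _ hx
      isClosed' := S.exelIdeal.isClosed'.preimage (S.continuous_toeplitzGauge z) }
  refine hx J ?_
  rintro _ ⟨a, ha, y, hy, rfl⟩
  change S.toeplitzGauge z (S.i a - y) ∈ S.exelIdeal.carrier
  rw [map_sub, toeplitzGauge_i, S.toeplitzGauge_compactGraph z _ hy]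
  exact ClosedIdeal.subset_generatedBy _ ⟨a, ha, y, hy, rfl⟩

/-- The dual action `α̂` of the circle on `A ⋊_{α,L} ℕ`. -/
def dualAction (z : Circle) : S.ExelProduct →⋆ₙₐ[ℂ] S.ExelProduct :=
  S.exelIdeal.lift (S.Q.comp (S.toeplitzGauge z)) fun x hx =>
    (S.exelIdeal.quot_eq_zero_iff _).mpr (S.toeplitzGauge_mem z x hx)

lemma dualAction_j (z : Circle) (a : A) : S.dualAction z (S.j a) = S.j a :=
  congrArg S.Q (S.toeplitzGauge_i z a)

lemma dualAction_jt (z : Circle) (a : A) :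
    S.dualAction z (S.t.snd (S.j a)) = (z : ℂ) • S.t.snd (S.j a) := by
  have h : S.t.snd (S.j a) = S.Q (S.w a) := congrArg S.Q (S.s_snd a)
  rw [h, ← map_smul, ← toeplitzGauge_w]
  rfl

/-- The fixed-point algebra `(A ⋊_{α,L} ℕ)^α̂`. -/
def fixedPoints : NonUnitalStarSubalgebra ℂ S.ExelProduct where
  carrier := {x | ∀ z, S.dualAction z x = x}
  add_mem' hx hy z := by rw [map_add, hx z, hy z]
  zero_mem' z := map_zero _
  mul_mem' hx hy z := by rw [map_mul, hx z, hy z]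
  smul_mem' c x hx z := by rw [map_smul, hx z]
  star_mem' hx z := by rw [map_star, hx z]

instance : IsClosed (S.fixedPoints : Set S.ExelProduct) := by
  have : (S.fixedPoints : Set S.ExelProduct) = ⋂ z, {x | S.dualAction z x = x} := by
    ext x
    rw [Set.mem_iInter]
    rfl
  rw [this]
  refine isClosed_iInter fun z => isClosed_eq ?_ continuous_id
  exact AddMonoidHomClass.continuous_of_bound (S.dualAction z) 1 fun a => by
    rw [one_mul]; exact NonUnitalStarAlgHom.norm_apply_le _ _

/-- The inclusion of the fixed-point algebra. -/
def fixedIncl : S.fixedPoints →⋆ₙₐ[ℂ] S.ExelProduct :=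
  NonUnitalStarSubalgebraClass.subtype S.fixedPoints

end ExelSystem

/-! ### Stacey crossed products -/

/-- A Stacey-covariant representation of `(B, β)` in a C⋆-algebra `D`. -/
structure StaceyRep {B : Type*} [NonUnitalCStarAlgebra B] (β : B →⋆ₙₐ[ℂ] B) (D : Type*)
    [NonUnitalCStarAlgebra D] where
  /-- the representation of `B` -/
  π : B →⋆ₙₐ[ℂ] D
  nondegenerate : IsNondegenerate π
  /-- the isometry -/
  V : 𝓜(ℂ, D)
  isometry : star V * V = 1
  covariant : ∀ b, (π (β b) : 𝓜(ℂ, D)) = V * (π b : 𝓜(ℂ, D)) * star V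

/-- `(C, i_B, v)` is a Stacey crossed product of `(B, β)`: the C⋆-algebra `C` is generated by
`i_B(B) ∪ i_B(B)v`, and for every Stacey-covariant representation `(π, V)` in a C⋆-algebra `D`
there is a nondegenerate homomorphism `Φ = π × V` with `Φ ∘ i_B = π` and `Φ(v) = V`, where the
latter means `Φ(v x) = V Φ(x)` for all `x` in `C`. -/
def StaceyRep.IsCrossedProduct {B C : Type u} [NonUnitalCStarAlgebra B]
    [NonUnitalCStarAlgebra C] {β : B →⋆ₙₐ[ℂ] B} (ι : StaceyRep β C) : Prop :=
  IsGeneratedBy (Set.range ι.π ∪ Set.range fun b => ι.V.snd (ι.π b)) ∧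
    ∀ (D : Type u) [NonUnitalCStarAlgebra D] (ρ : StaceyRep β D),
      ∃ Φ : C →⋆ₙₐ[ℂ] D, IsNondegenerate Φ ∧ (∀ b, Φ (ι.π b) = ρ.π b) ∧
        ∀ x, Φ (ι.V.fst x) = ρ.V.fst (Φ x)

end CrossedProduct

end

open CrossedProduct

/-!
A Stacey-covariant representation `(π, V)` of the fixed-point algebra with `β = Ad t` satisfies
`π(β̄ⁱ(1)) = VⁱV*ⁱ`, where `β̄ⁱ(1) = tⁱt*ⁱ`. Hence `π` respects every identity among the elements
`j(a)tⁱt*ⁱj(b)`. In particular `β(j(a)) = j(α(a))β̄(1)` and `β(j(L(a))) = β̄(1)j(a)β̄(1)` make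
`(π ∘ j, V)` a Toeplitz-covariant representation of `(A, α, L)`. The Cuntz-type relations defining
the Exel crossed product only involve `j(a)` and `j(a)tt*j(b)`, so they already hold in the
fixed-point algebra and are preserved by `π`; thus `(π ∘ j, V)` integrates to the Exel crossed
product. The integrated form agrees with `π` because the elements `j(a)tⁱt*ⁱj(b)` span a dense
subspace of the fixed-point algebra, as one sees by averaging the dual action over roots of unity.
-/

noncomputable section

namespace CrossedProduct

open scoped CStarAlgebra

section Intertwining

variable {A B C : Type*} [NonUnitalCStarAlgebra A] [NonUnitalCStarAlgebra B]
  [NonUnitalCStarAlgebra C]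

lemma multiplier_ext {m n : 𝓜(ℂ, A)} (h : ∀ x, m.fst x = n.fst x) : m = n := by
  have h_snd (x : A) : m.snd x = n.snd x := by
    have h_mul (y : A) : m.snd x * y = n.snd x * y := by rw [m.central, n.central, h]
    rw [← sub_eq_zero, ← CStarRing.mul_star_self_eq_zero_iff, sub_mul, h_mul, sub_self]
  ext x
  exacts [h x, h_snd x]

lemma IsNondegenerate.eq_of_fst {π : A →⋆ₙₐ[ℂ] B} (hπ : IsNondegenerate π) {m n : 𝓜(ℂ, B)}
    (h : ∀ a, m.fst (π a) = n.fst (π a)) : m = n := by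
  suffices m.fst = n.fst from multiplier_ext fun x => DFunLike.congr_fun this x
  refine ContinuousLinearMap.ext_on hπ ?_
  rintro _ ⟨a, b, rfl⟩
  rw [fst_mul, fst_mul, h]

/-- `Φ(Ux) = VΦ(x)` and `Φ(xU) = Φ(x)V` for all `x`; for nondegenerate `Φ` this says that the
extension of `Φ` to the multiplier algebras maps `U` to `V`. -/
structure Intertwines (Φ : A →⋆ₙₐ[ℂ] B) (U : 𝓜(ℂ, A)) (V : 𝓜(ℂ, B)) : Prop where
  fst : ∀ x, Φ (U.fst x) = V.fst (Φ x)
  snd : ∀ x, Φ (U.snd x) = V.snd (Φ x)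

namespace Intertwines

variable {Φ : A →⋆ₙₐ[ℂ] B} {U U' : 𝓜(ℂ, A)} {V V' : 𝓜(ℂ, B)}

protected lemma star (h : Intertwines Φ U V) : Intertwines Φ (star U) (star V) where
  fst x := by simp only [DoubleCentralizer.star_fst, map_star, h.snd]
  snd x := by simp only [DoubleCentralizer.star_snd, map_star, h.fst]

protected lemma mul (h : Intertwines Φ U V) (h' : Intertwines Φ U' V') :
    Intertwines Φ (U * U') (V * V') where
  fst x := by simp only [DoubleCentralizer.mul_fst, mul_apply_eq_comp, h.fst, h'.fst]
  snd x := by simp only [DoubleCentralizer.mul_snd, mul_apply_eq_comp, h.snd, h'.snd]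

protected lemma one (Φ : A →⋆ₙₐ[ℂ] B) : Intertwines Φ 1 1 := ⟨fun _ => rfl, fun _ => rfl⟩

protected lemma zero (Φ : A →⋆ₙₐ[ℂ] B) : Intertwines Φ 0 0 :=
  ⟨fun _ => map_zero Φ, fun _ => map_zero Φ⟩

protected lemma pow (h : Intertwines Φ U V) (n : ℕ) : Intertwines Φ (U ^ n) (V ^ n) := by
  induction n with
  | zero => simpa only [pow_zero] using Intertwines.one Φ
  | succ n ih => simpa only [pow_succ] using ih.mul h

protected lemma add (h : Intertwines Φ U V) (h' : Intertwines Φ U' V') :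
    Intertwines Φ (U + U') (V + V') where
  fst x := by simp only [DoubleCentralizer.add_fst, add_apply, map_add, h.fst, h'.fst]
  snd x := by simp only [DoubleCentralizer.add_snd, add_apply, map_add, h.snd, h'.snd]

protected lemma smul (h : Intertwines Φ U V) (c : ℂ) : Intertwines Φ (c • U) (c • V) where
  fst x := by simp only [DoubleCentralizer.smul_fst, smul_apply, map_smul, h.fst]
  snd x := by simp only [DoubleCentralizer.smul_snd, smul_apply, map_smul, h.snd]

protected lemma id (U : 𝓜(ℂ, A)) : Intertwines (NonUnitalStarAlgHom.id ℂ A) U U :=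
  ⟨fun _ => rfl, fun _ => rfl⟩

protected lemma comp {Ψ : B →⋆ₙₐ[ℂ] C} {W : 𝓜(ℂ, C)} (hΨ : Intertwines Ψ V W)
    (hΦ : Intertwines Φ U V) : Intertwines (Ψ.comp Φ) U W where
  fst x := by rw [NonUnitalStarAlgHom.comp_apply, hΦ.fst, hΨ.fst, NonUnitalStarAlgHom.comp_apply]
  snd x := by rw [NonUnitalStarAlgHom.comp_apply, hΦ.snd, hΨ.snd, NonUnitalStarAlgHom.comp_apply]

protected lemma coe (Φ : A →⋆ₙₐ[ℂ] B) (a : A) :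
    Intertwines Φ (a : 𝓜(ℂ, A)) (Φ a : 𝓜(ℂ, B)) where
  fst x := by simp
  snd x := by simp

lemma right_unique (hΦ : IsNondegenerate Φ) (h : Intertwines Φ U V) (h' : Intertwines Φ U V') :
    V = V' :=
  hΦ.eq_of_fst fun a => (h.fst a).symm.trans (h'.fst a)

lemma left_unique (hΦ : Function.Injective Φ) (h : Intertwines Φ U V)
    (h' : Intertwines Φ U' V) : U = U' :=
  multiplier_ext fun x => hΦ <| by rw [h.fst, h'.fst]

lemma map_eq (hΦ : IsNondegenerate Φ) {a : A} (h : Intertwines Φ (a : 𝓜(ℂ, A)) V) :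
    (Φ a : 𝓜(ℂ, B)) = V :=
  (Intertwines.coe Φ a).right_unique hΦ h

end Intertwines

namespace IsNondegenerate

variable {π : A →⋆ₙₐ[ℂ] B} {Φ : B →⋆ₙₐ[ℂ] C}

lemma of_comp (h : IsNondegenerate (Φ.comp π)) : IsNondegenerate Φ := by
  refine h.mono (Submodule.span_mono ?_)
  rintro _ ⟨a, c, rfl⟩
  exact ⟨π a, c, rfl⟩

lemma of_surjective (hΦ : Function.Surjective Φ) : IsNondegenerate Φ := by
  obtain ⟨l, _, -, hl, -⟩ := exists_approxUnit C
  refine fun x => mem_closure_of_tendsto (hl x) (.of_forall fun e => ?_)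
  obtain ⟨b, rfl⟩ := hΦ e
  exact Submodule.subset_span ⟨b, x, rfl⟩

lemma intertwines (hΦ : IsNondegenerate Φ) {U : 𝓜(ℂ, B)} {V : 𝓜(ℂ, C)}
    (h : ∀ x, Φ (U.fst x) = V.fst (Φ x)) : Intertwines Φ U V where
  fst := h
  snd x := by
    apply coe_injective
    refine hΦ.eq_of_fst fun b => ?_
    change Φ (U.snd x) * Φ b = V.snd (Φ x) * Φ b
    rw [V.central, ← h, ← map_mul, ← map_mul, U.central]

lemma intertwines_of_comp (hπ : IsNondegenerate π) (hΦ : IsNondegenerate Φ) {U : 𝓜(ℂ, B)}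
    {V : 𝓜(ℂ, C)} (h : ∀ a, Φ (U.fst (π a)) = V.fst (Φ (π a))) : Intertwines Φ U V := by
  let Φ' : B →L[ℂ] C := ⟨(Φ : B →ₗ[ℂ] C), map_continuous Φ⟩
  suffices Φ' ∘L U.fst = V.fst ∘L Φ' from hΦ.intertwines fun x => DFunLike.congr_fun this x
  refine ContinuousLinearMap.ext_on hπ ?_
  rintro _ ⟨a, b, rfl⟩
  change Φ (U.fst (π a * b)) = V.fst (Φ (π a * b))
  rw [fst_mul, map_mul, map_mul, fst_mul, h]

end IsNondegenerate

end Intertwining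

section StrictConvergence

variable {A B C : Type*} [NonUnitalCStarAlgebra A] [NonUnitalCStarAlgebra B]
  [NonUnitalCStarAlgebra C] {ι : Type*} {l : Filter ι}

/-- The family `w` in `A`, regarded as a family of multipliers, converges strictly to `m`. -/
structure StrictTendsto (w : ι → A) (l : Filter ι) (m : 𝓜(ℂ, A)) : Prop where
  fst : ∀ x, Tendsto (fun e => w e * x) l (𝓝 (m.fst x))
  snd : ∀ x, Tendsto (fun e => x * w e) l (𝓝 (m.snd x))

lemma exists_strictTendsto_one (A : Type*) [NonUnitalCStarAlgebra A] :
    ∃ l : Filter A, l.NeBot ∧ (∀ᶠ e in l, ‖e‖ ≤ 1) ∧ StrictTendsto id l 1 := by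
  obtain ⟨l, hl, h_bound, h_fst, h_snd⟩ := exists_approxUnit A
  exact ⟨l, hl, h_bound.mono fun e he => he.1, ⟨h_fst, h_snd⟩⟩

namespace StrictTendsto

variable {w : ι → A} {m : 𝓜(ℂ, A)}

lemma const_mul (h : StrictTendsto w l m) (n : 𝓜(ℂ, A)) :
    StrictTendsto (fun e => n.fst (w e)) l (n * m) where
  fst x := by
    simp only [← fst_mul]
    exact (n.fst.continuous.tendsto _).comp (h.fst x)
  snd x := by
    simp only [← n.central]
    exact h.snd (n.snd x)

lemma intertwines [l.NeBot] {π : A →⋆ₙₐ[ℂ] B} {M : 𝓜(ℂ, B)} (h : StrictTendsto w l m)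
    (h' : StrictTendsto (π ∘ w) l M) : Intertwines π m M where
  fst x := by
    refine tendsto_nhds_unique (((map_continuous π).tendsto _).comp (h.fst x)) ?_
    simpa only [Function.comp_def, map_mul] using h'.fst (π x)
  snd x := by
    refine tendsto_nhds_unique (((map_continuous π).tendsto _).comp (h.snd x)) ?_
    simpa only [Function.comp_def, map_mul] using h'.snd (π x)

end StrictTendsto

namespace IsNondegenerate

variable {π : A →⋆ₙₐ[ℂ] B} {w : ι → A} {m : 𝓜(ℂ, A)}

lemma exists_tendsto_mul [l.NeBot] (hπ : IsNondegenerate π) (hw : ∀ᶠ e in l, ‖w e‖ ≤ 1)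
    (h : ∀ a, ∃ b, Tendsto (fun e => w e * a) l (𝓝 b)) (x : B) :
    ∃ y, Tendsto (fun e => π (w e) * x) l (𝓝 y) := by
  refine exists_tendsto_of_dense (fun e => LinearMap.mulLeft ℂ (π (w e))) ?_ hπ ?_ x
  · filter_upwards [hw] with e he x
    exact (norm_mul_le _ _).trans (mul_le_of_le_one_left (norm_nonneg _)
      ((NonUnitalStarAlgHom.norm_apply_le π _).trans he))
  · intro x hx
    simp only [LinearMap.mulLeft_apply]
    induction hx using Submodule.span_induction with
    | mem x hx =>
      obtain ⟨a, b, rfl⟩ := hx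
      obtain ⟨c, hc⟩ := h a
      simp only [← mul_assoc, ← map_mul]
      exact ⟨π c * b, (((map_continuous π).tendsto c).comp hc).mul_const b⟩
    | zero => exact ⟨0, by simpa only [mul_zero] using tendsto_const_nhds⟩
    | add x y _ _ hx hy =>
      obtain ⟨x', hx⟩ := hx
      obtain ⟨y', hy⟩ := hy
      exact ⟨x' + y', by simpa only [mul_add] using hx.add hy⟩
    | smul c x _ hx =>
      obtain ⟨x', hx⟩ := hx
      exact ⟨c • x', by simpa only [mul_smul_comm] using hx.const_smul c⟩

lemma exists_strictTendsto [l.NeBot] (hπ : IsNondegenerate π) (hw : ∀ᶠ e in l, ‖w e‖ ≤ 1)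
    (h : StrictTendsto w l m) : ∃ M, StrictTendsto (π ∘ w) l M := by
  have h_star (a : A) : Tendsto (fun e => star (w e) * a) l (𝓝 (star (m.snd (star a)))) := by
    simpa only [star_mul, star_star] using (h.snd (star a)).star
  have h_snd (x : B) : ∃ y, Tendsto (fun e => x * π (w e)) l (𝓝 y) := by
    obtain ⟨y, hy⟩ := hπ.exists_tendsto_mul (w := fun e => star (w e))
      (by simpa only [norm_star] using hw) (fun a => ⟨_, h_star a⟩) (star x)
    exact ⟨star y, by simpa only [map_star, star_mul, star_star] using hy.star⟩
  obtain ⟨M, h_fst, h_snd⟩ := exists_strict_limit (w := π ∘ w) (C := 1)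
    (hw.mono fun e he => (NonUnitalStarAlgHom.norm_apply_le π _).trans he)
    (hπ.exists_tendsto_mul hw fun a => ⟨_, h.fst a⟩) h_snd
  exact ⟨M, h_fst, h_snd⟩

lemma strictTendsto_one [l.NeBot] (hπ : IsNondegenerate π) (hw : ∀ᶠ e in l, ‖w e‖ ≤ 1)
    (h : StrictTendsto w l 1) : StrictTendsto (π ∘ w) l 1 := by
  obtain ⟨M, hM⟩ := hπ.exists_strictTendsto hw h
  rwa [(h.intertwines hM).right_unique hπ (.one π)] at hM

lemma comp {Φ : B →⋆ₙₐ[ℂ] C} (hΦ : IsNondegenerate Φ) (hπ : IsNondegenerate π) :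
    IsNondegenerate (Φ.comp π) := by
  obtain ⟨l, _, hb, hl⟩ := exists_strictTendsto_one A
  set D := Submodule.span ℂ {x : C | ∃ a c, x = Φ.comp π a * c}
  have h_le : Submodule.span ℂ {x | ∃ b c, x = Φ b * c} ≤ D.topologicalClosure := by
    refine Submodule.span_le.mpr ?_
    rintro _ ⟨b, c, rfl⟩
    refine D.isClosed_topologicalClosure.mem_of_tendsto
      (((map_continuous Φ).tendsto _).comp ((hπ.strictTendsto_one hb hl).fst b) |>.mul_const c)
      (.of_forall fun e => D.le_topologicalClosure (Submodule.subset_span ⟨e, Φ b * c, ?_⟩))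
    simp only [Function.comp_apply, map_mul, mul_assoc, NonUnitalStarAlgHom.comp_apply]
  exact fun x => closure_minimal h_le D.isClosed_topologicalClosure (hΦ x)

lemma of_injective_comp {Φ : B →⋆ₙₐ[ℂ] C} (hΦ : Function.Injective Φ)
    (h : IsNondegenerate (Φ.comp π)) : IsNondegenerate π := by
  obtain ⟨l, _, hb, hl⟩ := exists_strictTendsto_one A
  intro x
  have h_lim : Tendsto (fun e => π e * x) l (𝓝 x) := by
    rw [(NonUnitalStarAlgHom.isometry Φ hΦ).isEmbedding.tendsto_nhds_iff]
    simpa only [Function.comp_def, map_mul] using! (h.strictTendsto_one hb hl).fst (Φ x)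
  exact mem_closure_of_tendsto h_lim (.of_forall fun e => Submodule.subset_span ⟨e, x, rfl⟩)

lemma exists_intertwines_of_norm_le_one (hπ : IsNondegenerate π) (hm : ‖m.fst‖ ≤ 1) :
    ∃ M, Intertwines π m M := by
  obtain ⟨l, _, hb, hl⟩ := exists_strictTendsto_one A
  have h_lim : StrictTendsto (fun e => m.fst e) l m :=
    mul_one m ▸ hl.const_mul m
  obtain ⟨M, hM⟩ := hπ.exists_strictTendsto
    (hb.mono fun e he => (m.fst.le_of_opNorm_le_of_le hm he).trans_eq (mul_one 1)) h_lim
  exact ⟨M, h_lim.intertwines hM⟩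

lemma exists_intertwines (hπ : IsNondegenerate π) (m : 𝓜(ℂ, A)) : ∃ M, Intertwines π m M := by
  have hc : (0 : ℝ) < ‖m.fst‖ + 1 := by positivity
  set c : ℂ := ((‖m.fst‖ + 1 : ℝ) : ℂ) with hc_def
  obtain ⟨M, hM⟩ := hπ.exists_intertwines_of_norm_le_one (m := c⁻¹ • m) <| by
    rw [DoubleCentralizer.smul_fst, norm_smul, norm_inv, hc_def, Complex.norm_real,
      Real.norm_of_nonneg hc.le, inv_mul_le_one₀ hc]
    exact le_add_of_nonneg_right zero_le_one
  refine ⟨c • M, ?_⟩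
  have h := hM.smul c
  rwa [smul_inv_smul₀ (Complex.ofReal_ne_zero.mpr hc.ne')] at h

/-- The extension of a nondegenerate homomorphism to the multiplier algebras. -/
def extend (hπ : IsNondegenerate π) : 𝓜(ℂ, A) →⋆ₙₐ[ℂ] 𝓜(ℂ, B) :=
  have h := fun m => (hπ.exists_intertwines m).choose_spec
  { toFun := fun m => (hπ.exists_intertwines m).choose
    map_smul' := fun c m => (h (c • m)).right_unique hπ ((h m).smul c)
    map_zero' := (h 0).right_unique hπ (.zero π)
    map_add' := fun m n => (h (m + n)).right_unique hπ ((h m).add (h n))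
    map_mul' := fun m n => (h (m * n)).right_unique hπ ((h m).mul (h n))
    map_star' := fun m => (h (star m)).right_unique hπ (h m).star }

lemma intertwines_extend (hπ : IsNondegenerate π) (m : 𝓜(ℂ, A)) :
    Intertwines π m (hπ.extend m) :=
  (hπ.exists_intertwines m).choose_spec

end IsNondegenerate

end StrictConvergence

section Conjugation

variable {A B : Type*} [NonUnitalCStarAlgebra A] [NonUnitalCStarAlgebra B]

/-- Conjugation `x ↦ V x V*` by a multiplier. -/
def conj (V : 𝓜(ℂ, A)) (x : A) : A := V.fst ((star V).snd x)

lemma coe_conj (V : 𝓜(ℂ, A)) (x : A) :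
    ((conj V x : A) : 𝓜(ℂ, A)) = V * (x : 𝓜(ℂ, A)) * star V := by
  rw [conj, ← mul_coe, ← coe_mul, mul_assoc]

lemma conj_mul (V : 𝓜(ℂ, A)) (x y : A) : conj V x * y = V.fst (x * (star V).fst y) := by
  rw [conj, ← fst_mul, (star V).central]

lemma mul_conj (V : 𝓜(ℂ, A)) (x y : A) : x * conj V y = (star V).snd (V.snd x * y) := by
  rw [conj, ← V.central, snd_mul]

lemma conj_smul_of_norm_eq_one {c : ℂ} (hc : ‖c‖ = 1) (V : 𝓜(ℂ, A)) (x : A) :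
    conj (c • V) x = conj V x := by
  have h : star c * c = 1 := by
    rw [Complex.star_def, mul_comm, Complex.mul_conj, Complex.normSq_eq_norm_sq, hc, one_pow,
      Complex.ofReal_one]
  simp only [conj, star_smul, DoubleCentralizer.smul_fst, DoubleCentralizer.smul_snd,
    smul_apply, map_smul, smul_smul, h, one_smul]

lemma conj_star_conj {V : 𝓜(ℂ, A)} (hV : star V * V = 1) (x : A) :
    conj (star V) (conj V x) = x := by
  apply coe_injective
  simp only [coe_conj, star_star, mul_assoc, hV, mul_one]
  rw [← mul_assoc, hV, one_mul]

/-- Conjugation by an isometry, as a homomorphism. -/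
def conjHom {V : 𝓜(ℂ, A)} (hV : star V * V = 1) : A →⋆ₙₐ[ℂ] A where
  toFun := conj V
  map_smul' c x := by simp [conj]
  map_zero' := by simp [conj]
  map_add' x y := by simp [conj]
  map_mul' x y := by
    apply coe_injective
    simp only [← coe_mul_coe, coe_conj, mul_assoc]
    rw [← mul_assoc (star V) V, hV, one_mul]
  map_star' x := by
    apply coe_injective
    simp only [← star_coe, coe_conj, star_mul, star_star, mul_assoc]

lemma StrictTendsto.conj {ι : Type*} {l : Filter ι} {w : ι → A} {m : 𝓜(ℂ, A)}
    (h : StrictTendsto w l m) (V : 𝓜(ℂ, A)) :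
    StrictTendsto (fun e => conj V (w e)) l (V * m * star V) where
  fst x := by
    simp only [conj_mul]
    exact (V.fst.continuous.tendsto _).comp (h.fst _)
  snd x := by
    simp only [mul_conj]
    exact ((star V).snd.continuous.tendsto _).comp (h.snd _)

lemma Intertwines.map_conj {Φ : A →⋆ₙₐ[ℂ] B} {U : 𝓜(ℂ, A)} {V : 𝓜(ℂ, B)}
    (h : Intertwines Φ U V) (x : A) : Φ (conj U x) = conj V (Φ x) := by
  rw [conj, conj, h.fst, h.star.snd]

end Conjugation

namespace IsGeneratedBy

variable {B C : Type*} [NonUnitalCStarAlgebra B] [NonUnitalCStarAlgebra C] {s : Set B}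

lemma hom_ext (hs : IsGeneratedBy s) {f g : B →⋆ₙₐ[ℂ] C} (h : ∀ x ∈ s, f x = g x) : f = g := by
  have h_le : (NonUnitalStarAlgebra.adjoin ℂ s).topologicalClosure ≤
      NonUnitalStarAlgHom.equalizer f g :=
    NonUnitalStarSubalgebra.topologicalClosure_minimal _ (NonUnitalStarAlgebra.adjoin_le h)
      (isClosed_eq (map_continuous f) (map_continuous g))
  rw [hs] at h_le
  ext x
  exact h_le (x := x) trivial

lemma image (hs : IsGeneratedBy s) {f : B →⋆ₙₐ[ℂ] C} (hf : Function.Surjective f) :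
    IsGeneratedBy (f '' s) := by
  have h_le : (NonUnitalStarAlgebra.adjoin ℂ s).topologicalClosure ≤
      ((NonUnitalStarAlgebra.adjoin ℂ (f '' s)).topologicalClosure).comap f :=
    NonUnitalStarSubalgebra.topologicalClosure_minimal _
      (NonUnitalStarAlgebra.adjoin_le fun x hx =>
        NonUnitalStarSubalgebra.le_topologicalClosure _
          (NonUnitalStarAlgebra.subset_adjoin ℂ _ ⟨x, hx, rfl⟩))
      ((NonUnitalStarSubalgebra.isClosed_topologicalClosure _).preimage (map_continuous f))
  rw [hs] at h_le
  refine top_le_iff.mp fun y _ => ?_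
  obtain ⟨x, rfl⟩ := hf y
  exact h_le (x := x) trivial

lemma mono {s' : Set B} (hs : IsGeneratedBy s) (h : s ⊆ s') : IsGeneratedBy s' :=
  top_le_iff.mp (hs.ge.trans
    (NonUnitalStarSubalgebra.topologicalClosure_mono (NonUnitalStarAlgebra.adjoin_mono h)))

/-- The set of right multipliers of a closed subspace is a closed subalgebra. -/
lemma mul_mem (hs : IsGeneratedBy s) {D : Submodule ℂ B} (hD : IsClosed (D : Set B))
    (h : ∀ y ∈ s, ∀ x ∈ D, x * y ∈ D) (h_star : ∀ y ∈ s, ∀ x ∈ D, x * star y ∈ D) {x : B}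
    (hx : x ∈ D) (y : B) : x * y ∈ D := by
  have h_adjoin {z : B} (hz : z ∈ NonUnitalStarAlgebra.adjoin ℂ s) : ∀ x ∈ D, x * z ∈ D := by
    refine NonUnitalAlgebra.adjoin_induction (s := s ∪ star s)
      (p := fun z _ => ∀ x ∈ D, x * z ∈ D) ?_ ?_ ?_ ?_ ?_ hz
    · rintro z (hz | hz)
      · exact h z hz
      · simpa only [star_star] using h_star _ hz
    · intro y z _ _ hy hz x hx
      rw [mul_add]
      exact D.add_mem (hy x hx) (hz x hx)
    · intro x _
      rw [mul_zero]
      exact D.zero_mem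
    · intro y z _ _ hy hz x hx
      rw [← mul_assoc]
      exact hz _ (hy x hx)
    · intro c y _ hy x hx
      rw [mul_smul_comm]
      exact D.smul_mem c (hy x hx)
  have h_closed : IsClosed {z | x * z ∈ D} :=
    hD.preimage (continuous_const.mul continuous_id)
  have hy : y ∈ (NonUnitalStarAlgebra.adjoin ℂ s).topologicalClosure := hs ▸ trivial
  exact closure_minimal (fun z hz => h_adjoin hz x hx) h_closed hy

end IsGeneratedBy

section StrictExtension

variable {A B : Type*} [NonUnitalCStarAlgebra A] [NonUnitalCStarAlgebra B]
  {ι : Type*} {l : Filter ι} {w : ι → A}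

lemma strictTendsto_iff_tendsto_nhds {m : 𝓜(ℂ, A)} :
    StrictTendsto w l m ↔
      Tendsto (fun e => (w e : 𝓜(ℂ, A))) l (@nhds 𝓜(ℂ, A) (strictTopology A) m) := by
  rw [nhds_induced, tendsto_comap_iff, tendsto_pi_nhds]
  simp only [Prod.tendsto_iff]
  exact ⟨fun h x => ⟨h.fst x, h.snd x⟩, fun h => ⟨fun x => (h x).1, fun x => (h x).2⟩⟩

lemma IsStrictExtension.strictTendsto {α : A →⋆ₙₐ[ℂ] A} {αbar : 𝓜(ℂ, A) →⋆ₙₐ[ℂ] 𝓜(ℂ, A)}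
    (hα : IsStrictExtension α αbar) {m : 𝓜(ℂ, A)} (h : StrictTendsto w l m) :
    StrictTendsto (fun e => α (w e)) l (αbar m) := by
  rw [strictTendsto_iff_tendsto_nhds] at h ⊢
  let _ : TopologicalSpace 𝓜(ℂ, A) := strictTopology A
  simpa only [Function.comp_def, hα.2] using (hα.1.tendsto m).comp h

lemma exists_strictTendsto_of_injective [l.NeBot] {π : A →⋆ₙₐ[ℂ] B} (hπ : Function.Injective π)
    {M : 𝓜(ℂ, B)} {C : ℝ} (hw : ∀ᶠ e in l, ‖w e‖ ≤ C)
    (h : StrictTendsto (fun e => π (w e)) l M) : ∃ m, StrictTendsto w l m := by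
  have hπ_embed := (NonUnitalStarAlgHom.isometry π hπ).isClosedEmbedding
  have h_lift {v : ι → A} {y : B} (hv : Tendsto (fun e => π (v e)) l (𝓝 y)) :
      ∃ x, Tendsto v l (𝓝 x) := by
    obtain ⟨x, rfl⟩ := hπ_embed.isClosed_range.mem_of_tendsto hv (.of_forall fun e => ⟨v e, rfl⟩)
    exact ⟨x, hπ_embed.isEmbedding.tendsto_nhds_iff.mpr hv⟩
  obtain ⟨m, h_fst, h_snd⟩ := exists_strict_limit hw
    (fun x => h_lift (by simpa only [map_mul] using h.fst (π x)))
    (fun x => h_lift (by simpa only [map_mul] using h.snd (π x)))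
  exact ⟨m, h_fst, h_snd⟩

end StrictExtension

lemma exists_mul_star_eq_of_mem {E : Type*} [NonUnitalCStarAlgebra E]
    (F : NonUnitalStarSubalgebra ℂ E) [IsClosed (F : Set E)] {y : E} (hy : y * star y ∈ F) :
    ∃ d ∈ F, d * star d = y * star y := by
  let _ := CStarAlgebra.spectralOrder E
  let _ := CStarAlgebra.spectralOrderedRing E
  have h_sqrt : IsSelfAdjoint (CFC.sqrt (y * star y)) := .of_nonneg (CFC.sqrt_nonneg _)
  refine ⟨CFC.sqrt (y * star y), ?_, ?_⟩
  · rw [CFC.sqrt_eq_real_sqrt _ (mul_star_self_nonneg y)]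
    exact cfcₙ_mem (s := F) _ hy
  · rw [h_sqrt.star_eq, CFC.sqrt_mul_sqrt_self _ (mul_star_self_nonneg y)]

lemma norm_fst_of_isometry {E : Type*} [NonUnitalCStarAlgebra E] {V : 𝓜(ℂ, E)}
    (hV : star V * V = 1) (x : E) : ‖V.fst x‖ = ‖x‖ := by
  have h : star (V.fst x) * V.fst x = star x * x := by
    apply coe_injective
    simp only [← coe_mul_coe, ← star_coe, ← mul_coe, star_mul, mul_assoc]
    rw [← mul_assoc (star V), hV, one_mul]
  rw [← mul_self_inj (norm_nonneg _) (norm_nonneg _), ← CStarRing.norm_star_mul_self, h,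
    CStarRing.norm_star_mul_self]

lemma fst_mul_star_fst {E : Type*} [NonUnitalCStarAlgebra E] (M : 𝓜(ℂ, E)) (x : E) :
    M.fst x * star (M.fst x) = conj M (x * star x) := by
  apply coe_injective
  simp only [coe_conj, ← coe_mul_coe, ← star_coe, ← mul_coe, star_mul, mul_assoc]

lemma norm_fst_eq_of_mul_star_eq {E : Type*} [NonUnitalCStarAlgebra E] {x y : E}
    (h : x * star x = y * star y) (M : 𝓜(ℂ, E)) : ‖M.fst x‖ = ‖M.fst y‖ := by
  rw [← mul_self_inj (norm_nonneg _) (norm_nonneg _), ← CStarRing.norm_self_mul_star,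
    fst_mul_star_fst, h, ← fst_mul_star_fst, CStarRing.norm_self_mul_star]

lemma continuous_of_dist_eq {X E : Type*} [TopologicalSpace X] [PseudoMetricSpace E] {f g : X → E}
    (hg : Continuous g) (h : ∀ a b, dist (f a) (f b) = dist (g a) (g b)) : Continuous f := by
  refine continuous_iff_continuousAt.mpr fun a => ?_
  rw [ContinuousAt, tendsto_iff_dist_tendsto_zero]
  simp only [h]
  exact tendsto_iff_dist_tendsto_zero.mp (hg.tendsto a)

namespace StaceyRep

variable {B D : Type*} [NonUnitalCStarAlgebra B] [NonUnitalCStarAlgebra D] {β : B →⋆ₙₐ[ℂ] B}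
  (ρ : StaceyRep β D)

lemma π_β (b : B) : ρ.π (β b) = conj ρ.V (ρ.π b) :=
  coe_injective <| (ρ.covariant b).trans (coe_conj _ _).symm

lemma exists_strictTendsto_one_image : ∃ l : Filter B, l.NeBot ∧ (∀ᶠ e in l, ‖e‖ ≤ 1) ∧
    StrictTendsto id l 1 ∧ StrictTendsto ρ.π l 1 := by
  obtain ⟨l, hl, hb, h_lim⟩ := exists_strictTendsto_one B
  exact ⟨l, hl, hb, h_lim, ρ.nondegenerate.strictTendsto_one hb h_lim⟩

lemma strictTendsto_π_β {l : Filter B} (hl : StrictTendsto ρ.π l 1) {m : 𝓜(ℂ, B)} {M : 𝓜(ℂ, D)}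
    (h : Intertwines ρ.π m M) :
    StrictTendsto (fun e => ρ.π (β (m.fst e))) l (ρ.V * M * star ρ.V) := by
  simpa only [π_β, h.fst, mul_one] using (hl.const_mul M).conj ρ.V

lemma intertwines_extension {βbar : 𝓜(ℂ, B) →⋆ₙₐ[ℂ] 𝓜(ℂ, B)} (hβ : IsStrictExtension β βbar)
    {m : 𝓜(ℂ, B)} {M : 𝓜(ℂ, D)} (h : Intertwines ρ.π m M) :
    Intertwines ρ.π (βbar m) (ρ.V * M * star ρ.V) := by
  obtain ⟨l, _, -, hl, hπ⟩ := ρ.exists_strictTendsto_one_image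
  have hm : StrictTendsto (fun e => m.fst e) l m := mul_one m ▸ hl.const_mul m
  exact (hβ.strictTendsto hm).intertwines (ρ.strictTendsto_π_β hπ h)

lemma intertwines_iterate_extension_one {βbar : 𝓜(ℂ, B) →⋆ₙₐ[ℂ] 𝓜(ℂ, B)}
    (hβ : IsStrictExtension β βbar) (n : ℕ) :
    Intertwines ρ.π (βbar^[n] 1) (ρ.V ^ n * star ρ.V ^ n) := by
  induction n with
  | zero => simpa only [pow_zero, mul_one] using! Intertwines.one ρ.π
  | succ n ih =>
    rw [Function.iterate_succ_apply', pow_succ', pow_succ]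
    simpa only [mul_assoc] using ρ.intertwines_extension hβ ih

lemma V_mul_π (b : B) :
    ρ.V * (ρ.π b : 𝓜(ℂ, D)) = (ρ.π (β b) : 𝓜(ℂ, D)) * ρ.V := by
  rw [ρ.covariant, mul_assoc, ρ.isometry, mul_one]

section Faithful

variable {ρ} (hρ : Function.Injective ρ.π)

include hρ

lemma β_injective : Function.Injective β := fun x y h => hρ <| by
  rw [← conj_star_conj ρ.isometry (ρ.π x), ← π_β, h, π_β, conj_star_conj ρ.isometry]

lemma exists_intertwines_conj (m : 𝓜(ℂ, B)) :
    ∃ m', Intertwines ρ.π m' (ρ.V * ρ.nondegenerate.extend m * star ρ.V) := by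
  obtain ⟨l, _, hb, -, hπ⟩ := ρ.exists_strictTendsto_one_image
  have h_lim := ρ.strictTendsto_π_β hπ (ρ.nondegenerate.intertwines_extend m)
  have h_bound : ∀ᶠ e in l, ‖β (m.fst e)‖ ≤ ‖m.fst‖ := hb.mono fun e he =>
    (NonUnitalStarAlgHom.norm_apply_le β _).trans (m.fst.unit_le_opNorm e he)
  obtain ⟨m', hm'⟩ := exists_strictTendsto_of_injective hρ h_bound h_lim
  exact ⟨m', hm'.intertwines h_lim⟩

/-- The extension `m ↦ V m V*` of `β` to the multiplier algebra, when `β` is represented by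
conjugation with `V` in a faithful representation. -/
def extension : 𝓜(ℂ, B) →⋆ₙₐ[ℂ] 𝓜(ℂ, B) :=
  have h := fun m => (exists_intertwines_conj hρ m).choose_spec
  { toFun := fun m => (exists_intertwines_conj hρ m).choose
    map_smul' := fun c m => (h (c • m)).left_unique hρ <| by
      simpa only [map_smul, mul_smul_comm, smul_mul_assoc, MonoidHom.id_apply]
        using! (h m).smul c
    map_zero' := (h 0).left_unique hρ <| by
      simpa only [map_zero, mul_zero, zero_mul] using Intertwines.zero ρ.π
    map_add' := fun m n => (h (m + n)).left_unique hρ <| by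
      simpa only [map_add, mul_add, add_mul] using (h m).add (h n)
    map_mul' := fun m n => (h (m * n)).left_unique hρ <| by
      have h_cancel (x : 𝓜(ℂ, D)) : star ρ.V * (ρ.V * x) = x := by
        rw [← mul_assoc, ρ.isometry, one_mul]
      simpa only [map_mul, mul_assoc, h_cancel] using (h m).mul (h n)
    map_star' := fun m => (h (star m)).left_unique hρ <| by
      simpa only [map_star, star_mul, star_star, mul_assoc] using (h m).star }

lemma intertwines_extension_of_injective (m : 𝓜(ℂ, B)) :
    Intertwines ρ.π (extension hρ m) (ρ.V * ρ.nondegenerate.extend m * star ρ.V) :=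
  (exists_intertwines_conj hρ m).choose_spec

lemma extension_coe (b : B) : extension hρ (b : 𝓜(ℂ, B)) = (β b : 𝓜(ℂ, B)) := by
  have h := intertwines_extension_of_injective hρ (b : 𝓜(ℂ, B))
  rw [(ρ.nondegenerate.intertwines_extend _).right_unique ρ.nondegenerate (.coe _ b),
    ← ρ.covariant] at h
  exact h.left_unique hρ (.coe _ _)

variable (h_mem : ∀ b, conj (star ρ.V) (ρ.π b) ∈ Set.range ρ.π)

include h_mem

lemma exists_norm_extension_fst (x : B) :
    ∃ d, ∀ m, ‖(extension hρ m).fst x‖ = ‖m.fst d‖ := by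
  have h_isometry := NonUnitalStarAlgHom.isometry ρ.π hρ
  let F := NonUnitalStarAlgHom.range ρ.π
  have : IsClosed (F : Set D) := by
    simpa only [F, NonUnitalStarAlgHom.coe_range] using h_isometry.isClosedEmbedding.isClosed_range
  set y := (star ρ.V).fst (ρ.π x)
  have hy : y * star y ∈ F := by
    rw [fst_mul_star_fst, ← map_star, ← map_mul]
    exact h_mem _
  obtain ⟨_, ⟨d, rfl⟩, hd⟩ := exists_mul_star_eq_of_mem F hy
  refine ⟨d, fun m => ?_⟩
  set M := ρ.nondegenerate.extend m
  calc ‖(extension hρ m).fst x‖ = ‖ρ.V.fst (M.fst y)‖ := by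
        rw [← h_isometry.norm_map_of_map_zero (map_zero _),
          (intertwines_extension_of_injective hρ m).fst]
        rfl
    _ = ‖M.fst y‖ := norm_fst_of_isometry ρ.isometry _
    _ = ‖M.fst (ρ.π d)‖ := norm_fst_eq_of_mul_star_eq hd.symm M
    _ = ‖m.fst d‖ := by
        rw [← (ρ.nondegenerate.intertwines_extend m).fst,
          h_isometry.norm_map_of_map_zero (map_zero _)]

lemma isStrictExtension_extension : IsStrictExtension β (extension hρ) := by
  refine ⟨?_, extension_coe hρ⟩
  let _ : TopologicalSpace 𝓜(ℂ, B) := strictTopology B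
  have h_eval : Continuous fun (m : 𝓜(ℂ, B)) (b : B) => (m.fst b, m.snd b) :=
    continuous_induced_dom
  refine continuous_induced_rng.mpr (continuous_pi fun x => .prodMk ?_ ?_)
  · obtain ⟨d, hd⟩ := exists_norm_extension_fst hρ h_mem x
    refine continuous_of_dist_eq (g := fun m : 𝓜(ℂ, B) => m.fst d)
      (continuous_fst.comp ((continuous_apply d).comp h_eval)) fun m n => ?_
    simpa only [dist_eq_norm, map_sub] using! hd (m - n)
  · obtain ⟨d, hd⟩ := exists_norm_extension_fst hρ h_mem (star x)
    refine continuous_of_dist_eq (g := fun m : 𝓜(ℂ, B) => m.snd (star d))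
      (continuous_snd.comp ((continuous_apply (star d)).comp h_eval)) fun m n => ?_
    have h := hd (star (m - n))
    rw [map_star (extension hρ), DoubleCentralizer.star_fst, DoubleCentralizer.star_fst, norm_star,
      norm_star, star_star, map_sub] at h
    simpa only [dist_eq_norm] using! h

end Faithful

end StaceyRep

namespace StaceyRep

lemma exists_π_β_eq_iff {B D : Type*} [NonUnitalCStarAlgebra B] [NonUnitalCStarAlgebra D]
    {β : B →⋆ₙₐ[ℂ] B} (ρ : StaceyRep β D) (h_mem : ∀ b, conj (star ρ.V) (ρ.π b) ∈ Set.range ρ.π)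
    (y : D) : (∃ b, ρ.π (β b) = y) ↔
      ∃ b, (y : 𝓜(ℂ, D)) = ρ.V * star ρ.V * (ρ.π b : 𝓜(ℂ, D)) * (ρ.V * star ρ.V) := by
  constructor
  · rintro ⟨b, rfl⟩
    refine ⟨β b, ?_⟩
    have h_cancel (x : 𝓜(ℂ, D)) : star ρ.V * (ρ.V * x) = x := by
      rw [← mul_assoc, ρ.isometry, one_mul]
    simp only [ρ.covariant, mul_assoc, h_cancel]
  · rintro ⟨b, hb⟩
    obtain ⟨c, hc⟩ := h_mem b
    refine ⟨c, coe_injective ?_⟩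
    simp only [hb, π_β, hc, coe_conj, star_star, mul_assoc]

variable {B C D : Type u} [NonUnitalCStarAlgebra B] [NonUnitalCStarAlgebra C]
  [NonUnitalCStarAlgebra D] {β : B →⋆ₙₐ[ℂ] B} {ι : StaceyRep β C} {κ : StaceyRep β D}

lemma IsCrossedProduct.hom_ext (hι : ι.IsCrossedProduct) {V : 𝓜(ℂ, D)}
    {Φ Ψ : C →⋆ₙₐ[ℂ] D} (hΦ : Intertwines Φ ι.V V) (hΨ : Intertwines Ψ ι.V V)
    (h : ∀ b, Φ (ι.π b) = Ψ (ι.π b)) : Φ = Ψ := by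
  refine hι.1.hom_ext ?_
  rintro _ (⟨b, rfl⟩ | ⟨b, rfl⟩)
  · exact h b
  · exact (hΦ.snd _).trans ((congrArg V.snd (h b)).trans (hΨ.snd _).symm)

lemma IsCrossedProduct.exists_equiv (hι : ι.IsCrossedProduct) (hκ : κ.IsCrossedProduct) :
    ∃ Φ : C ≃⋆ₐ[ℂ] D, (∀ b, Φ (ι.π b) = κ.π b) ∧ ∀ c, Φ (ι.V.fst c) = κ.V.fst (Φ c) := by
  obtain ⟨Φ, hΦ, hΦ_π, hΦ_V⟩ := hι.2 D κ
  obtain ⟨Ψ, hΨ, hΨ_π, hΨ_V⟩ := hκ.2 C ι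
  have hΦ_int := hΦ.intertwines hΦ_V
  have hΨ_int := hΨ.intertwines hΨ_V
  have h_left : Ψ.comp Φ = NonUnitalStarAlgHom.id ℂ C :=
    hι.hom_ext (hΨ_int.comp hΦ_int) (.id _) fun b => by simp [hΦ_π, hΨ_π]
  have h_right : Φ.comp Ψ = NonUnitalStarAlgHom.id ℂ D :=
    hκ.hom_ext (hΦ_int.comp hΨ_int) (.id _) fun b => by simp [hΦ_π, hΨ_π]
  exact ⟨StarAlgEquiv.ofBijective Φ
    ⟨Function.LeftInverse.injective (g := Ψ) (DFunLike.congr_fun h_left),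
      Function.RightInverse.surjective (g := Ψ) (DFunLike.congr_fun h_right)⟩, hΦ_π, hΦ_V⟩

end StaceyRep

section CircleAverage

variable {E : Type*} [NormedAddCommGroup E] [NormedSpace ℂ E] (γ : Circle → E →ₗ[ℂ] E)

/-- `x` lies in the spectral subspace of degree `d` of the family `γ` of operators. -/
def IsHomogeneous (d : ℤ) (x : E) : Prop := ∀ z, γ z x = ((z ^ d : Circle) : ℂ) • x

/-- The average of the operators `γ z` over the `N`-th roots of unity `z`. It plays the role of the
conditional expectation `x ↦ ∫ γ z x dz`, without any continuity assumption on `γ`. -/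
def rootAverage (N : ℕ) : E →ₗ[ℂ] E :=
  (N : ℂ)⁻¹ • ∑ n ∈ Finset.range N, γ (Circle.exp (2 * Real.pi / N) ^ n)

lemma rootAverage_apply (N : ℕ) (x : E) : rootAverage γ N x =
    (N : ℂ)⁻¹ • ∑ n ∈ Finset.range N, γ (Circle.exp (2 * Real.pi / N) ^ n) x := by
  rw [rootAverage, LinearMap.smul_apply, LinearMap.sum_apply]

variable {γ}

lemma rootAverage_of_fixed {N : ℕ} (hN : N ≠ 0) {x : E} (hx : ∀ z, γ z x = x) :
    rootAverage γ N x = x := by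
  simp only [rootAverage_apply, hx, Finset.sum_const, Finset.card_range]
  rw [← Nat.cast_smul_eq_nsmul ℂ, inv_smul_smul₀ (Nat.cast_ne_zero.mpr hN)]

lemma norm_rootAverage_le (hγ : ∀ z x, ‖γ z x‖ ≤ ‖x‖) (N : ℕ) (x : E) :
    ‖rootAverage γ N x‖ ≤ ‖x‖ := by
  rcases N.eq_zero_or_pos with rfl | hN
  · simp [rootAverage]
  rw [rootAverage_apply, norm_smul, norm_inv, Complex.norm_natCast,
    inv_mul_le_iff₀ (Nat.cast_pos.mpr hN)]
  refine (norm_sum_le_of_le _ fun n _ => hγ _ x).trans_eq ?_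
  rw [Finset.sum_const, Finset.card_range, nsmul_eq_mul]

lemma isPrimitiveRoot_circleExp {N : ℕ} (hN : N ≠ 0) :
    IsPrimitiveRoot (Circle.exp (2 * Real.pi / N)) N := by
  refine .of_map_of_injective (f := Circle.coeHom) ?_ Circle.coe_injective
  convert Complex.isPrimitiveRoot_exp N hN using 1
  change ((Circle.exp _ : Circle) : ℂ) = _
  rw [Circle.coe_exp]
  push_cast
  ring_nf

lemma IsHomogeneous.rootAverage_eq_zero {d : ℤ} {x : E} (hx : IsHomogeneous γ d x) {N : ℕ}
    (hd : ¬ (N : ℤ) ∣ d) : rootAverage γ N x = 0 := by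
  rcases eq_or_ne N 0 with rfl | hN
  · simp [rootAverage]
  set ω := Circle.exp (2 * Real.pi / N)
  have hω : IsPrimitiveRoot ω N := isPrimitiveRoot_circleExp hN
  set ζ : ℂ := ((ω ^ d : Circle) : ℂ)
  have hζ : ζ ≠ 1 := fun h => hd <|
    (hω.zpow_eq_one_iff_dvd d).mp (Circle.coe_eq_one.mp h)
  have hζN : ζ ^ N = 1 := by
    rw [← Circle.coe_pow, Circle.coe_eq_one, ← zpow_natCast, zpow_comm, zpow_natCast,
      hω.pow_eq_one, one_zpow]
  have h_term (n : ℕ) : γ (ω ^ n) x = ζ ^ n • x := by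
    rw [hx, ← Circle.coe_pow, ← zpow_natCast, zpow_comm, zpow_natCast]
  rw [rootAverage_apply, Finset.sum_congr rfl fun n _ => h_term n, ← Finset.sum_smul,
    geom_sum_eq hζ, hζN, sub_self, zero_div, zero_smul, smul_zero]

variable {s : ℤ → Set E} (hs : ∀ d, ∀ x ∈ s d, IsHomogeneous γ d x)

include hs

lemma eventually_rootAverage_mem_span {x : E} (hx : x ∈ Submodule.span ℂ (⋃ d, s d)) :
    ∀ᶠ N in atTop, rootAverage γ N x ∈ Submodule.span ℂ (s 0) := by
  induction hx using Submodule.span_induction with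
  | mem x hx =>
    obtain ⟨d, hx⟩ := Set.mem_iUnion.mp hx
    rcases eq_or_ne d 0 with rfl | hd
    · filter_upwards [eventually_ne_atTop 0] with N hN
      rw [rootAverage_of_fixed hN fun z => by rw [hs 0 x hx, zpow_zero, Circle.coe_one, one_smul]]
      exact Submodule.subset_span hx
    · filter_upwards [eventually_gt_atTop d.natAbs] with N hN
      rw [(hs d x hx).rootAverage_eq_zero fun h =>
        hN.not_ge (Nat.le_of_dvd (Int.natAbs_pos.mpr hd) (Int.natCast_dvd.mp h))]
      exact zero_mem _
  | zero => exact .of_forall fun N => by rw [map_zero]; exact zero_mem _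
  | add x y _ _ hx hy =>
    filter_upwards [hx, hy] with N hx hy
    rw [map_add]
    exact add_mem hx hy
  | smul c x _ hx =>
    filter_upwards [hx] with N hx
    rw [map_smul]
    exact Submodule.smul_mem _ c hx

theorem mem_closure_span_of_fixed (hγ : ∀ z x, ‖γ z x‖ ≤ ‖x‖) {x : E} (hx : ∀ z, γ z x = x)
    (h : x ∈ closure (Submodule.span ℂ (⋃ d, s d) : Set E)) :
    x ∈ closure (Submodule.span ℂ (s 0) : Set E) := by
  refine Metric.mem_closure_iff.mpr fun ε hε => ?_
  obtain ⟨y, hy, h_dist⟩ := Metric.mem_closure_iff.mp h ε hε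
  obtain ⟨N, h_mem, hN⟩ :=
    ((eventually_rootAverage_mem_span hs hy).and (eventually_ne_atTop 0)).exists
  refine ⟨rootAverage γ N y, h_mem, ?_⟩
  calc dist x (rootAverage γ N y) = ‖rootAverage γ N (x - y)‖ := by
        rw [map_sub, rootAverage_of_fixed hN hx, dist_eq_norm]
    _ ≤ ‖x - y‖ := norm_rootAverage_le hγ N _
    _ < ε := by rwa [← dist_eq_norm]

end CircleAverage

section ClosedSpan

variable {A B E F : Type*} [NonUnitalCStarAlgebra A] [NonUnitalCStarAlgebra B]
  [NormedAddCommGroup E] [NormedSpace ℂ E] [NormedAddCommGroup F] [NormedSpace ℂ F]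

lemma map_mem_of_mem_closure_span (f : E →L[ℂ] F) {s : Set E} {G : Submodule ℂ F}
    (hG : IsClosed (G : Set F)) (h : ∀ x ∈ s, f x ∈ G) {x : E}
    (hx : x ∈ closure (Submodule.span ℂ s : Set E)) : f x ∈ G :=
  closure_minimal (Submodule.span_le.mpr h : Submodule.span ℂ s ≤ G.comap (f : E →ₗ[ℂ] F))
    (hG.preimage f.continuous) hx

namespace IsNondegenerate

variable {π : A →⋆ₙₐ[ℂ] B}

lemma mem_of_map_mul_mem (hπ : IsNondegenerate π) {s : Set B} (hs : IsClosed s) {x : B}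
    (h : ∀ a, π a * x ∈ s) : x ∈ s := by
  obtain ⟨l, _, hb, hl⟩ := exists_strictTendsto_one A
  exact hs.mem_of_tendsto ((hπ.strictTendsto_one hb hl).fst x) (.of_forall h)

lemma mem_of_mul_map_mem (hπ : IsNondegenerate π) {s : Set B} (hs : IsClosed s) {x : B}
    (h : ∀ a, x * π a ∈ s) : x ∈ s := by
  obtain ⟨l, _, hb, hl⟩ := exists_strictTendsto_one A
  exact hs.mem_of_tendsto ((hπ.strictTendsto_one hb hl).snd x) (.of_forall h)

end IsNondegenerate

end ClosedSpan

namespace ExelSystem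

variable {A : Type u} [NonUnitalCStarAlgebra A] (S : ExelSystem A)

section Relations

lemma Q_nondegenerate : IsNondegenerate S.Q := .of_surjective S.exelIdeal.quot_surjective

lemma j_nondegenerate : IsNondegenerate S.j := S.Q_nondegenerate.comp S.i_nondegenerate

lemma intertwines_Q_s : Intertwines S.Q S.s S.t := ⟨fun _ => rfl, fun _ => rfl⟩

lemma Q_w (a : A) : S.Q (S.w a) = S.t.snd (S.j a) := congrArg S.Q (S.s_snd a).symm

lemma t_mul_j (a : A) : S.t * (S.j a : 𝓜(ℂ, S.ExelProduct)) =
    (S.j (S.α a) : 𝓜(ℂ, S.ExelProduct)) * S.t := by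
  have h_cov : S.s * (S.i a : 𝓜(ℂ, S.ToeplitzAlg)) = (S.i (S.α a) : 𝓜(ℂ, S.ToeplitzAlg)) * S.s :=
    S.toeplitzRep.covariant a
  have h := S.intertwines_Q_s.mul (.coe S.Q (S.i a))
  rw [h_cov] at h
  exact h.right_unique S.Q_nondegenerate ((Intertwines.coe _ _).mul S.intertwines_Q_s)

lemma star_t_mul_j_mul_t (a : A) : star S.t * (S.j a : 𝓜(ℂ, S.ExelProduct)) * S.t =
    (S.j (S.L a) : 𝓜(ℂ, S.ExelProduct)) := by
  have h_transfer : star S.s * (S.i a : 𝓜(ℂ, S.ToeplitzAlg)) * S.s =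
      (S.i (S.L a) : 𝓜(ℂ, S.ToeplitzAlg)) := S.toeplitzRep.transfer a
  have h := (S.intertwines_Q_s.star.mul (.coe S.Q (S.i a))).mul S.intertwines_Q_s
  rw [h_transfer] at h
  exact h.right_unique S.Q_nondegenerate (.coe _ _)

lemma j_mul_star_t (a : A) : (S.j a : 𝓜(ℂ, S.ExelProduct)) * star S.t =
    star S.t * (S.j (S.α a) : 𝓜(ℂ, S.ExelProduct)) := by
  simpa only [star_mul, star_coe, map_star, star_star] using congrArg star (S.t_mul_j (star a))

lemma L_α (a : A) : S.L (S.α a) = a := by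
  obtain ⟨Lbar, -, -, h_mul, h_one⟩ := S.transfer
  have h := h_mul a 1
  rwa [h_one] at h

lemma t_fst_j (a : A) : S.t.fst (S.j a) = S.t.snd (S.j (S.α a)) := by
  apply coe_injective
  simp only [← mul_coe, ← coe_mul, t_mul_j]

lemma star_t_mul_t : star S.t * S.t = 1 := by
  refine S.j_nondegenerate.eq_of_fst fun a => ?_
  apply coe_injective
  simp only [← mul_coe, one_mul]
  rw [mul_assoc, t_mul_j, ← mul_assoc, star_t_mul_j_mul_t, L_α]

lemma t_pow_mul_j (i : ℕ) (a : A) : S.t ^ i * (S.j a : 𝓜(ℂ, S.ExelProduct)) =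
    (S.j (S.α^[i] a) : 𝓜(ℂ, S.ExelProduct)) * S.t ^ i := by
  induction i with
  | zero => simp
  | succ i ih =>
    rw [pow_succ', mul_assoc, ih, ← mul_assoc, t_mul_j, mul_assoc, Function.iterate_succ_apply']

lemma isGeneratedBy_j_t :
    IsGeneratedBy (Set.range S.j ∪ Set.range fun a => S.t.snd (S.j a)) := by
  have h := S.generated_i_w.image S.exelIdeal.quot_surjective
  rw [Set.image_union, ← Set.range_comp, ← Set.range_comp] at h
  simpa only [← Q_w] using! h

end Relations

section Monomials

/-- The element `j(a) tⁱ t*ᵏ j(b)` of the Exel crossed product. -/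
def mon (a b : A) (i k : ℕ) : S.ExelProduct := (S.t ^ i * star S.t ^ k).snd (S.j a) * S.j b

lemma coe_mon (a b : A) (i k : ℕ) : ((S.mon a b i k : S.ExelProduct) : 𝓜(ℂ, S.ExelProduct)) =
    (S.j a : 𝓜(ℂ, S.ExelProduct)) * S.t ^ i * star S.t ^ k *
      (S.j b : 𝓜(ℂ, S.ExelProduct)) := by
  simp only [mon, ← coe_mul_coe, ← coe_mul, mul_assoc]

/-- The elements `j(a) tⁱ t*ᵏ j(b)` with `i - k = d`. -/
def monomials (d : ℤ) : Set S.ExelProduct :=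
  {x | ∃ (a b : A) (i k : ℕ), (i : ℤ) - k = d ∧ S.mon a b i k = x}

/-- The closed linear span of the elements `j(a) tⁱ t*ᵏ j(b)`. -/
def closedMonSpan : Submodule ℂ S.ExelProduct :=
  (Submodule.span ℂ (⋃ d, S.monomials d)).topologicalClosure

lemma isClosed_closedMonSpan : IsClosed (S.closedMonSpan : Set S.ExelProduct) :=
  Submodule.isClosed_topologicalClosure _

lemma mon_mem_closedMonSpan (a b : A) (i k : ℕ) : S.mon a b i k ∈ S.closedMonSpan :=
  Submodule.le_topologicalClosure _ <|
    Submodule.subset_span (Set.mem_iUnion.mpr ⟨_, a, b, i, k, rfl, rfl⟩)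

lemma mul_mem_closedMonSpan {y : S.ExelProduct}
    (h : ∀ a b i k, S.mon a b i k * y ∈ S.closedMonSpan) {x : S.ExelProduct}
    (hx : x ∈ S.closedMonSpan) : x * y ∈ S.closedMonSpan := by
  refine map_mem_of_mem_closure_span ((ContinuousLinearMap.mul ℂ S.ExelProduct).flip y)
    S.isClosed_closedMonSpan (fun x hx => ?_) hx
  obtain ⟨d, a, b, i, k, -, rfl⟩ := Set.mem_iUnion.mp hx
  exact h a b i k

lemma mon_mul_j (a b c : A) (i k : ℕ) : S.mon a b i k * S.j c = S.mon a (b * c) i k := by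
  rw [mon, mon, mul_assoc, ← map_mul]

lemma mon_mul_star_t_snd_j (a b c : A) (i k : ℕ) :
    S.mon a b i k * star (S.t.snd (S.j c)) = S.mon a (S.α b * star c) i (k + 1) := by
  apply coe_injective
  simp only [← coe_mul_coe, coe_mon, ← star_coe, ← coe_mul, star_mul, map_mul, pow_succ, map_star,
    mul_assoc]
  rw [← mul_assoc (S.j b : 𝓜(ℂ, S.ExelProduct)), j_mul_star_t, mul_assoc]

lemma mon_succ_mul_t_snd_j (a b c d : A) (i k : ℕ) :
    S.mon a b i (k + 1) * S.t.snd (S.j c) * S.j d = S.mon a (S.L (b * c) * d) i k := by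
  apply coe_injective
  simp only [← coe_mul_coe, coe_mon, ← coe_mul, map_mul, pow_succ, ← star_t_mul_j_mul_t, mul_assoc]

lemma mon_zero_mul_t_snd_j (a b c d : A) (i : ℕ) :
    S.mon a b i 0 * S.t.snd (S.j c) * S.j d = S.mon (a * S.α^[i] (b * c)) d (i + 1) 0 := by
  apply coe_injective
  calc _ = (S.j a : 𝓜(ℂ, S.ExelProduct)) * (S.t ^ i * (S.j (b * c) : 𝓜(ℂ, S.ExelProduct))) *
        S.t * (S.j d : 𝓜(ℂ, S.ExelProduct)) := by
        simp only [← coe_mul_coe, coe_mon, ← coe_mul, map_mul, pow_zero, mul_one, mul_assoc]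
    _ = _ := by
        rw [t_pow_mul_j]
        simp only [← coe_mul_coe, coe_mon, map_mul, pow_succ, pow_zero, mul_one, mul_assoc]

lemma mul_mem_closedMonSpan_of_mem {x : S.ExelProduct} (hx : x ∈ S.closedMonSpan)
    (y : S.ExelProduct) : x * y ∈ S.closedMonSpan := by
  refine S.isGeneratedBy_j_t.mul_mem S.isClosed_closedMonSpan ?_ ?_ hx y
  · rintro _ (⟨c, rfl⟩ | ⟨c, rfl⟩) x hx
    · refine S.mul_mem_closedMonSpan (fun a b i k => ?_) hx
      rw [mon_mul_j]
      exact S.mon_mem_closedMonSpan _ _ _ _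
    · refine S.mul_mem_closedMonSpan (fun a b i k => ?_) hx
      refine S.j_nondegenerate.mem_of_mul_map_mem S.isClosed_closedMonSpan fun d => ?_
      cases k with
      | zero => exact S.mon_zero_mul_t_snd_j a b c d i ▸ S.mon_mem_closedMonSpan _ _ _ _
      | succ k => exact S.mon_succ_mul_t_snd_j a b c d i k ▸ S.mon_mem_closedMonSpan _ _ _ _
  · rintro _ (⟨c, rfl⟩ | ⟨c, rfl⟩) x hx
    · refine S.mul_mem_closedMonSpan (fun a b i k => ?_) hx
      rw [← map_star, mon_mul_j]
      exact S.mon_mem_closedMonSpan _ _ _ _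
    · refine S.mul_mem_closedMonSpan (fun a b i k => ?_) hx
      rw [mon_mul_star_t_snd_j]
      exact S.mon_mem_closedMonSpan _ _ _ _

lemma mem_closedMonSpan (x : S.ExelProduct) : x ∈ S.closedMonSpan := by
  have h_j (c : A) : S.j c ∈ S.closedMonSpan := by
    refine S.j_nondegenerate.mem_of_mul_map_mem S.isClosed_closedMonSpan fun d => ?_
    simpa [mon] using S.mon_mem_closedMonSpan c d 0 0
  exact S.j_nondegenerate.mem_of_map_mul_mem S.isClosed_closedMonSpan fun c =>
    S.mul_mem_closedMonSpan_of_mem (h_j c) x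

end Monomials

section DualAction

variable (z : Circle)

lemma dualAction_nondegenerate : IsNondegenerate (S.dualAction z) := by
  have h : (S.dualAction z).comp S.j = S.j := by
    ext a
    exact S.dualAction_j z a
  exact .of_comp (h ▸ S.j_nondegenerate)

lemma intertwines_dualAction_t : Intertwines (S.dualAction z) S.t ((z : ℂ) • S.t) := by
  refine S.j_nondegenerate.intertwines_of_comp (S.dualAction_nondegenerate z) fun a => ?_
  rw [t_fst_j, dualAction_jt, dualAction_j, DoubleCentralizer.smul_fst, smul_apply, t_fst_j]

lemma dualAction_conj_t (x : S.ExelProduct) :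
    S.dualAction z (conj S.t x) = conj S.t (S.dualAction z x) := by
  rw [(S.intertwines_dualAction_t z).map_conj, conj_smul_of_norm_eq_one (Circle.norm_coe z)]

lemma dualAction_conj_star_t (x : S.ExelProduct) :
    S.dualAction z (conj (star S.t) x) = conj (star S.t) (S.dualAction z x) := by
  rw [(S.intertwines_dualAction_t z).star.map_conj, star_smul,
    conj_smul_of_norm_eq_one (by rw [norm_star, Circle.norm_coe])]

lemma dualAction_mon (a b : A) (i k : ℕ) :
    S.dualAction z (S.mon a b i k) = ((z ^ ((i : ℤ) - k) : Circle) : ℂ) • S.mon a b i k := by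
  have hz : ((z ^ ((i : ℤ) - k) : Circle) : ℂ) = (z : ℂ) ^ i * star (z : ℂ) ^ k := by
    rw [zpow_sub, zpow_natCast, zpow_natCast, ← inv_pow, Circle.coe_mul, Circle.coe_pow,
      Circle.coe_pow, Circle.coe_inv_eq_conj, Complex.star_def]
  have h := ((S.intertwines_dualAction_t z).pow i).mul ((S.intertwines_dualAction_t z).star.pow k)
  rw [mon, map_mul, h.snd, dualAction_j, dualAction_j, star_smul, smul_pow, smul_pow,
    smul_mul_assoc, mul_smul_comm, smul_smul, DoubleCentralizer.smul_snd, smul_apply,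
    smul_mul_assoc, hz]

lemma mon_mem_fixedPoints (a b : A) (i : ℕ) : S.mon a b i i ∈ S.fixedPoints := fun z => by
  rw [dualAction_mon, sub_self, zpow_zero, Circle.coe_one, one_smul]

/-- The element `j(a) tⁱ t*ⁱ j(b)` of the fixed-point algebra. -/
def monFixed (a b : A) (i : ℕ) : S.fixedPoints := ⟨S.mon a b i i, S.mon_mem_fixedPoints a b i⟩

theorem mem_closure_span_monomials_zero {x : S.ExelProduct} (hx : x ∈ S.fixedPoints) :
    x ∈ closure (Submodule.span ℂ (S.monomials 0) : Set S.ExelProduct) := by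
  refine mem_closure_span_of_fixed
    (γ := fun z => (S.dualAction z : S.ExelProduct →ₗ[ℂ] S.ExelProduct)) ?_
    (fun z => NonUnitalStarAlgHom.norm_apply_le (S.dualAction z)) hx (S.mem_closedMonSpan x)
  rintro _ _ ⟨a, b, i, k, rfl, rfl⟩ z
  exact S.dualAction_mon z a b i k

end DualAction

section FixedPointEndomorphism

/-- The homomorphism `j` with values in the fixed-point algebra. -/
def jFixed : A →⋆ₙₐ[ℂ] S.fixedPoints :=
  NonUnitalStarAlgHom.codRestrict S.j S.fixedPoints fun a z => S.dualAction_j z a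

lemma fixedIncl_injective : Function.Injective S.fixedIncl := Subtype.val_injective

lemma jFixed_nondegenerate : IsNondegenerate S.jFixed :=
  .of_injective_comp S.fixedIncl_injective S.j_nondegenerate

/-- The endomorphism `x ↦ t x t*` of the fixed-point algebra. -/
def β : S.fixedPoints →⋆ₙₐ[ℂ] S.fixedPoints :=
  NonUnitalStarAlgHom.codRestrict ((conjHom S.star_t_mul_t).comp S.fixedIncl) S.fixedPoints
    fun x z => (S.dualAction_conj_t z x).trans (congrArg (conj S.t) (x.2 z))

lemma coe_β (x : S.fixedPoints) : ((S.β x : S.ExelProduct) : 𝓜(ℂ, S.ExelProduct)) =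
    S.t * ((x : S.ExelProduct) : 𝓜(ℂ, S.ExelProduct)) * star S.t :=
  coe_conj S.t (x : S.ExelProduct)

/-- The inclusion of the fixed-point algebra and the isometry `t`, as a Stacey-covariant
representation of `β`. -/
def staceyRep : StaceyRep S.β S.ExelProduct where
  π := S.fixedIncl
  nondegenerate := .of_comp (π := S.jFixed) S.j_nondegenerate
  V := S.t
  isometry := S.star_t_mul_t
  covariant := S.coe_β

lemma conj_star_t_mem_range (x : S.fixedPoints) :
    conj (star S.t) (S.fixedIncl x) ∈ Set.range S.fixedIncl :=
  ⟨⟨_, fun z => (S.dualAction_conj_star_t z x).trans (congrArg (conj (star S.t)) (x.2 z))⟩, rfl⟩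

lemma coe_β_monFixed (a b : A) (i : ℕ) :
    ((S.β (S.monFixed a b i) : S.ExelProduct) : 𝓜(ℂ, S.ExelProduct)) =
      (S.j (S.α a) : 𝓜(ℂ, S.ExelProduct)) * S.t ^ (i + 1) * star S.t ^ (i + 1) *
        (S.j (S.α b) : 𝓜(ℂ, S.ExelProduct)) := by
  rw [coe_β, monFixed, coe_mon, pow_succ', pow_succ]
  simp only [mul_assoc]
  rw [j_mul_star_t, ← mul_assoc S.t, t_mul_j, mul_assoc]

/-- The extension `m ↦ t m t*` of `β` to the multiplier algebra. -/
def βbar : 𝓜(ℂ, S.fixedPoints) →⋆ₙₐ[ℂ] 𝓜(ℂ, S.fixedPoints) :=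
  StaceyRep.extension (ρ := S.staceyRep) S.fixedIncl_injective

lemma isStrictExtension_βbar : IsStrictExtension S.β S.βbar :=
  StaceyRep.isStrictExtension_extension (ρ := S.staceyRep) S.fixedIncl_injective
    S.conj_star_t_mem_range

lemma intertwines_fixedIncl_iterate_βbar_one (i : ℕ) :
    Intertwines S.fixedIncl (S.βbar^[i] 1) (S.t ^ i * star S.t ^ i) :=
  S.staceyRep.intertwines_iterate_extension_one S.isStrictExtension_βbar i

end FixedPointEndomorphism

end ExelSystem

namespace ClosedIdeal

variable {T D : Type*} [NonUnitalCStarAlgebra T] [NonUnitalCStarAlgebra D]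

/-- The kernel of a homomorphism, as a closed ideal. -/
def ker (f : T →⋆ₙₐ[ℂ] D) : ClosedIdeal T where
  toSubmodule := LinearMap.ker (f : T →ₗ[ℂ] D)
  mul_mem_left' x y (hy : f y = 0) := show f (x * y) = 0 by rw [map_mul, hy, mul_zero]
  mul_mem_right' x y (hx : f x = 0) := show f (x * y) = 0 by rw [map_mul, hx, zero_mul]
  star_mem' x (hx : f x = 0) := show f (star x) = 0 by rw [map_star, hx, star_zero]
  isClosed' := isClosed_eq (map_continuous f) continuous_const

lemma map_eq_zero_of_mem_generatedBy {f : T →⋆ₙₐ[ℂ] D} {X : Set T} (h : ∀ x ∈ X, f x = 0) {x : T}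
    (hx : x ∈ (generatedBy X).carrier) : f x = 0 :=
  hx (ker f) h

end ClosedIdeal

section PairRange

variable {B C D : Type*} [NonUnitalCStarAlgebra B] [NonUnitalCStarAlgebra C]
  [NonUnitalCStarAlgebra D]

/-- The set of pairs `(ι b, π b)`. For injective `ι` it is the graph of `π`, regarded as a map
defined on the range of `ι`. -/
def pairRange (ι : B →⋆ₙₐ[ℂ] C) (π : B →⋆ₙₐ[ℂ] D) : Submodule ℂ (C × D) :=
  LinearMap.range (ι.prod π : B →ₗ[ℂ] C × D)

lemma isClosed_pairRange {ι : B →⋆ₙₐ[ℂ] C} (hι : Function.Injective ι) (π : B →⋆ₙₐ[ℂ] D) :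
    IsClosed (pairRange ι π : Set (C × D)) :=
  (NonUnitalStarAlgHom.isometry (ι.prod π) fun _ _ h =>
    hι (congrArg Prod.fst h)).isClosedEmbedding.isClosed_range

end PairRange

namespace ExelSystem

variable {A D : Type u} [NonUnitalCStarAlgebra A] [NonUnitalCStarAlgebra D] (S : ExelSystem A)

section FixedPointMultipliers

variable {S} in
lemma coe_eq_of_intertwines_fixedIncl {x : S.fixedPoints} {m : 𝓜(ℂ, S.fixedPoints)}
    (h : Intertwines S.fixedIncl m ((x : S.ExelProduct) : 𝓜(ℂ, S.ExelProduct))) :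
    (x : 𝓜(ℂ, S.fixedPoints)) = m :=
  (Intertwines.coe S.fixedIncl x).left_unique S.fixedIncl_injective h

lemma intertwines_fixedIncl_jFixed (a : A) :
    Intertwines S.fixedIncl (S.jFixed a : 𝓜(ℂ, S.fixedPoints)) (S.j a : 𝓜(ℂ, S.ExelProduct)) :=
  .coe S.fixedIncl (S.jFixed a)

lemma coe_monFixed (a b : A) (i : ℕ) : (S.monFixed a b i : 𝓜(ℂ, S.fixedPoints)) =
    (S.jFixed a : 𝓜(ℂ, S.fixedPoints)) * S.βbar^[i] 1 *
      (S.jFixed b : 𝓜(ℂ, S.fixedPoints)) := by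
  apply coe_eq_of_intertwines_fixedIncl
  rw [monFixed, coe_mon, mul_assoc (S.j a : 𝓜(ℂ, S.ExelProduct))]
  exact ((S.intertwines_fixedIncl_jFixed a).mul (S.intertwines_fixedIncl_iterate_βbar_one i)).mul
    (S.intertwines_fixedIncl_jFixed b)

lemma coe_β_jFixed (a : A) : (S.β (S.jFixed a) : 𝓜(ℂ, S.fixedPoints)) =
    (S.jFixed (S.α a) : 𝓜(ℂ, S.fixedPoints)) * S.βbar 1 := by
  apply coe_eq_of_intertwines_fixedIncl
  rw [coe_β]
  have h_proj := S.intertwines_fixedIncl_iterate_βbar_one 1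
  have h := (S.intertwines_fixedIncl_jFixed (S.α a)).mul h_proj
  simpa only [Function.iterate_one, pow_one, ← mul_assoc, ← t_mul_j] using! h

lemma coe_β_jFixed_L (a : A) : (S.β (S.jFixed (S.L a)) : 𝓜(ℂ, S.fixedPoints)) =
    S.βbar 1 * (S.jFixed a : 𝓜(ℂ, S.fixedPoints)) * S.βbar 1 := by
  apply coe_eq_of_intertwines_fixedIncl
  have h_proj := S.intertwines_fixedIncl_iterate_βbar_one 1
  have h := (h_proj.mul (S.intertwines_fixedIncl_jFixed a)).mul h_proj
  rw [coe_β]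
  change Intertwines _ _ (S.t * (S.j (S.L a) : 𝓜(ℂ, S.ExelProduct)) * star S.t)
  simpa only [Function.iterate_one, pow_one, mul_assoc, ← star_t_mul_j_mul_t] using h

end FixedPointMultipliers

section Universality

variable {S} (ρ : StaceyRep S.β D)

lemma intertwines_iterate_βbar_one (i : ℕ) :
    Intertwines ρ.π (S.βbar^[i] 1) (ρ.V ^ i * star ρ.V ^ i) :=
  ρ.intertwines_iterate_extension_one S.isStrictExtension_βbar i

lemma coe_π_monFixed (a b : A) (i : ℕ) : (ρ.π (S.monFixed a b i) : 𝓜(ℂ, D)) =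
    (ρ.π (S.jFixed a) : 𝓜(ℂ, D)) * ρ.V ^ i * star ρ.V ^ i * (ρ.π (S.jFixed b) : 𝓜(ℂ, D)) := by
  refine Intertwines.map_eq ρ.nondegenerate ?_
  rw [coe_monFixed, mul_assoc (ρ.π (S.jFixed a) : 𝓜(ℂ, D))]
  exact ((Intertwines.coe _ _).mul (intertwines_iterate_βbar_one ρ i)).mul (.coe _ _)

lemma coe_π_β_jFixed (a : A) : (ρ.π (S.β (S.jFixed a)) : 𝓜(ℂ, D)) =
    (ρ.π (S.jFixed (S.α a)) : 𝓜(ℂ, D)) * (ρ.V * star ρ.V) := by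
  refine Intertwines.map_eq ρ.nondegenerate ?_
  rw [coe_β_jFixed]
  simpa only [pow_one, Function.iterate_one] using
    (Intertwines.coe _ _).mul (intertwines_iterate_βbar_one ρ 1)

lemma coe_π_β_jFixed_L (a : A) : (ρ.π (S.β (S.jFixed (S.L a))) : 𝓜(ℂ, D)) =
    ρ.V * star ρ.V * (ρ.π (S.jFixed a) : 𝓜(ℂ, D)) * (ρ.V * star ρ.V) := by
  refine Intertwines.map_eq ρ.nondegenerate ?_
  rw [coe_β_jFixed_L]
  have h := intertwines_iterate_βbar_one ρ 1
  simpa only [pow_one, Function.iterate_one] using (h.mul (.coe _ _)).mul h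

/-- The Toeplitz-covariant representation `(π ∘ j, V)` given by a Stacey-covariant representation
`(π, V)` of the fixed-point algebra. -/
def toeplitzOfStacey : ToeplitzRep S D where
  π := ρ.π.comp S.jFixed
  nondegenerate := ρ.nondegenerate.comp S.jFixed_nondegenerate
  V := ρ.V
  covariant a := by
    simp only [NonUnitalStarAlgHom.comp_apply]
    rw [ρ.V_mul_π, coe_π_β_jFixed, mul_assoc, mul_assoc, ρ.isometry, mul_one]
  transfer a := by
    simp only [NonUnitalStarAlgHom.comp_apply]
    have h_cancel (x : 𝓜(ℂ, D)) : star ρ.V * (ρ.V * x) = x := by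
      rw [← mul_assoc, ρ.isometry, one_mul]
    have h := (ρ.covariant _).symm.trans (coe_π_β_jFixed_L ρ a)
    simpa only [mul_assoc, h_cancel, ρ.isometry, mul_one] using
      (congrArg (fun m => star ρ.V * (m * ρ.V)) h).symm

lemma mem_pairRange_w_mul_star_w (a b : A) :
    (S.Q (S.w a * star (S.w b)), S.lift (toeplitzOfStacey ρ) (S.w a * star (S.w b))) ∈
      pairRange S.fixedIncl ρ.π := by
  refine ⟨S.monFixed a (star b) 1, Prod.ext ?_ ?_⟩
  · change S.mon a (star b) 1 1 = _
    apply coe_injective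
    simp only [map_mul, map_star, Q_w, coe_mon, pow_one, ← coe_mul_coe, ← star_coe, ← coe_mul,
      star_mul, mul_assoc]
  · apply coe_injective
    refine (coe_π_monFixed ρ a (star b) 1).trans ?_
    simp only [map_mul, map_star, lift_w, pow_one, ← coe_mul_coe, ← star_coe, ToeplitzRep.coe_w,
      star_mul, mul_assoc]
    rfl

lemma mem_pairRange_of_mem_compactGraph {p : (S.ML →L[ℂ] S.ML) × S.ToeplitzAlg}
    (hp : p ∈ S.compactGraph) :
    (S.Q p.2, S.lift (toeplitzOfStacey ρ) p.2) ∈ pairRange S.fixedIncl ρ.π := by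
  let Φ : S.ToeplitzAlg →⋆ₙₐ[ℂ] S.ExelProduct × D := S.Q.prod (S.lift (toeplitzOfStacey ρ))
  let f : S.ToeplitzAlg →L[ℂ] S.ExelProduct × D := ⟨(Φ : _ →ₗ[ℂ] _), map_continuous Φ⟩
  have h_closed := isClosed_pairRange S.fixedIncl_injective ρ.π
  refine map_mem_of_mem_closure_span (f ∘L .snd ℂ _ _) h_closed ?_ hp
  rintro _ ⟨m, n, rfl⟩
  change f (S.ψ m * star (S.ψ n)) ∈ _
  refine S.denseRange_q.induction_on₂ (h_closed.preimage (by fun_prop)) (fun a b => ?_) m n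
  rw [ψ_q, ψ_q]
  exact mem_pairRange_w_mul_star_w ρ a b

lemma lift_eq_zero_of_mem_exelRelations {x : S.ToeplitzAlg} (hx : x ∈ S.exelRelations) :
    S.lift (toeplitzOfStacey ρ) x = 0 := by
  have hQ : S.Q x = 0 :=
    (S.exelIdeal.quot_eq_zero_iff _).mpr (ClosedIdeal.subset_generatedBy _ hx)
  obtain ⟨a, -, y, hy, rfl⟩ := hx
  obtain ⟨x, hx⟩ := mem_pairRange_of_mem_compactGraph ρ hy
  have hx_Q : (x : S.ExelProduct) = S.Q y := congrArg Prod.fst hx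
  have hx_lift : ρ.π x = S.lift (toeplitzOfStacey ρ) y := congrArg Prod.snd hx
  rw [map_sub, sub_eq_zero, ← hx_Q] at hQ
  obtain rfl : S.jFixed a = x := Subtype.ext hQ
  rw [map_sub, ← hx_lift, lift_i]
  exact sub_self _

/-- The homomorphism on the Exel crossed product induced by a Stacey-covariant representation of
the fixed-point algebra. -/
def integrated : S.ExelProduct →⋆ₙₐ[ℂ] D :=
  S.exelIdeal.lift (S.lift (toeplitzOfStacey ρ)) fun _ hx =>
    ClosedIdeal.map_eq_zero_of_mem_generatedBy (fun _ => lift_eq_zero_of_mem_exelRelations ρ) hx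

lemma integrated_j (a : A) : integrated ρ (S.j a) = ρ.π (S.jFixed a) :=
  S.lift_i (toeplitzOfStacey ρ) a

lemma integrated_t_snd_j (a : A) :
    integrated ρ (S.t.snd (S.j a)) = ρ.V.snd (ρ.π (S.jFixed a)) := by
  rw [← Q_w]
  exact (S.lift_w (toeplitzOfStacey ρ) a).trans <|
    coe_injective <| ((toeplitzOfStacey ρ).coe_w a).trans (coe_mul _ _)

lemma integrated_nondegenerate : IsNondegenerate (integrated ρ) := by
  have h : (integrated ρ).comp S.j = ρ.π.comp S.jFixed := by
    ext a
    exact integrated_j ρ a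
  exact .of_comp (h ▸ ρ.nondegenerate.comp S.jFixed_nondegenerate)

lemma intertwines_integrated_t : Intertwines (integrated ρ) S.t ρ.V := by
  refine S.j_nondegenerate.intertwines_of_comp (integrated_nondegenerate ρ) fun a => ?_
  rw [t_fst_j, integrated_t_snd_j, integrated_j]
  apply coe_injective
  simp only [← mul_coe, ← coe_mul]
  exact ((toeplitzOfStacey ρ).covariant a).symm

lemma integrated_monFixed (a b : A) (i : ℕ) :
    integrated ρ (S.monFixed a b i) = ρ.π (S.monFixed a b i) := by
  have h_j (c : A) : Intertwines (integrated ρ) (S.j c : 𝓜(ℂ, S.ExelProduct))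
      (ρ.π (S.jFixed c) : 𝓜(ℂ, D)) := integrated_j ρ c ▸ .coe _ _
  have h_t := intertwines_integrated_t ρ
  have h := (((h_j a).mul (h_t.pow i)).mul (h_t.star.pow i)).mul (h_j b)
  rw [← coe_mon] at h
  exact coe_injective ((h.map_eq (integrated_nondegenerate ρ)).trans (coe_π_monFixed ρ a b i).symm)

lemma integrated_fixed (x : S.fixedPoints) : integrated ρ x = ρ.π x := by
  let Φ : S.ExelProduct →⋆ₙₐ[ℂ] S.ExelProduct × D :=
    (NonUnitalStarAlgHom.id ℂ S.ExelProduct).prod (integrated ρ)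
  let f : S.ExelProduct →L[ℂ] S.ExelProduct × D := ⟨(Φ : _ →ₗ[ℂ] _), map_continuous Φ⟩
  have h_mem : f x ∈ pairRange S.fixedIncl ρ.π := by
    refine map_mem_of_mem_closure_span f (isClosed_pairRange S.fixedIncl_injective ρ.π) ?_
      (S.mem_closure_span_monomials_zero x.2)
    rintro _ ⟨a, b, i, k, hik, rfl⟩
    obtain rfl : i = k := by omega
    exact ⟨S.monFixed a b i, Prod.ext rfl (integrated_monFixed ρ a b i).symm⟩
  obtain ⟨y, hy⟩ := h_mem
  obtain rfl : y = x := Subtype.ext (congrArg Prod.fst hy)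
  exact (congrArg Prod.snd hy).symm

end Universality

theorem isCrossedProduct_staceyRep : S.staceyRep.IsCrossedProduct := by
  refine ⟨S.isGeneratedBy_j_t.mono (Set.union_subset_union ?_ ?_), fun D _ ρ =>
    ⟨integrated ρ, integrated_nondegenerate ρ, integrated_fixed ρ,
      (intertwines_integrated_t ρ).fst⟩⟩
  all_goals
    rintro _ ⟨a, rfl⟩
    exact ⟨S.jFixed a, rfl⟩

end ExelSystem

end CrossedProduct

end

open CrossedProduct

theorem corollary4p1 {A : Type u} [NonUnitalCStarAlgebra A] (S : ExelSystem A) :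
    ∃ β : S.fixedPoints →⋆ₙₐ[ℂ] S.fixedPoints,
      Function.Injective β ∧
      (∀ (a b : A) (i : ℕ), ∃ x : S.fixedPoints,
        ((x : S.ExelProduct) : 𝓜(ℂ, S.ExelProduct)) =
          (S.j a : 𝓜(ℂ, S.ExelProduct)) * S.t ^ i * star S.t ^ i *
            (S.j b : 𝓜(ℂ, S.ExelProduct)) ∧
        ((β x : S.ExelProduct) : 𝓜(ℂ, S.ExelProduct)) =
          (S.j (S.α a) : 𝓜(ℂ, S.ExelProduct)) * S.t ^ (i + 1) * star S.t ^ (i + 1) *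
            (S.j (S.α b) : 𝓜(ℂ, S.ExelProduct))) ∧
      (∃ βbar : 𝓜(ℂ, S.fixedPoints) →⋆ₙₐ[ℂ] 𝓜(ℂ, S.fixedPoints),
        IsStrictExtension β βbar ∧
        ∀ x : S.fixedPoints,
          (((βbar 1).fst x : S.fixedPoints) : S.ExelProduct) = (S.t * star S.t).fst x ∧
          (((βbar 1).snd x : S.fixedPoints) : S.ExelProduct) = (S.t * star S.t).snd x) ∧
      (∀ y : S.ExelProduct, (∃ x : S.fixedPoints, (β x : S.ExelProduct) = y) ↔
        ∃ x : S.fixedPoints, (y : 𝓜(ℂ, S.ExelProduct)) =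
          S.t * star S.t * ((x : S.ExelProduct) : 𝓜(ℂ, S.ExelProduct)) * (S.t * star S.t)) ∧
      ∃ ρ : StaceyRep β S.ExelProduct, ρ.π = S.fixedIncl ∧ ρ.V = S.t ∧
        ρ.IsCrossedProduct ∧
        ∀ (C : Type u) [NonUnitalCStarAlgebra C] (ι : StaceyRep β C), ι.IsCrossedProduct →
          ∃ Φ : C ≃⋆ₐ[ℂ] S.ExelProduct, (∀ x, Φ (ι.π x) = x) ∧
            ∀ c, Φ (ι.V.fst c) = S.t.fst (Φ c) := by
  refine ⟨S.β, StaceyRep.β_injective (ρ := S.staceyRep) S.fixedIncl_injective,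
    fun a b i => ⟨S.monFixed a b i, S.coe_mon a b i i, S.coe_β_monFixed a b i⟩,
    ⟨S.βbar, S.isStrictExtension_βbar, fun x => ?_⟩,
    S.staceyRep.exists_π_β_eq_iff S.conj_star_t_mem_range,
    S.staceyRep, rfl, rfl, S.isCrossedProduct_staceyRep,
    fun _ _ _ hι => hι.exists_equiv S.isCrossedProduct_staceyRep⟩
  have h_one := S.intertwines_fixedIncl_iterate_βbar_one 1
  rw [Function.iterate_one, pow_one, pow_one] at h_one
  exact ⟨h_one.fst x, h_one.snd x⟩
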